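/- Let $\tau=\frac{1+\sqrt5}{2}$. **Tiles.** Let $t_1,\dots,t_6$ be the tetrahedra with edges of length $1$ or $\tau$ whose faces have side lengths: $t_1$: $2\times(1,1,1)$, $2\times(1,1,\tau)$; $t_2$: $(1,1,1)$, $2\times(1,1,\tau)$, $(1,\tau,\tau)$; $t_3$: $(\tau,\tau,\tau)$, $3\times(1,1,\tau)$; $t_4$: $(1,1,1)$, $3\times(1,\tau,\tau)$; $t_5$: $(\tau,\tau,\tau)$, $(1,1,\tau)$, $2\times(1,\tau,\tau)$; $t_6$: $2\times(\tau,\tau,\tau)$, $2\times(1,\tau,\tau)$. The composite tiles are the following solids, obtained by gluing tetrahedra along equilateral faces (and, for $T_1$, by inserting $C$ between the two legs of $E$): $$T_1=E+C,\quad E=t_4+t_1+t_4,\quad C=t_3+t_6+t_3,\qquad T_2=t_2+t_4,\qquad T_3=t_5+t_6+t_5,\qquad T_4=t_3+t_6+t_5 .$$ The $t_5$ in $T_3$ are placed so that $T_3$ is a pyramid over a regular pentagon of side $1$ with lateral edges $\tau$, and $T_4$ arises from $T_3$ by replacing one $t_5$ by $t_3$. Explicitly, up to congruence and in units of half the short edge,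 $T_1,\dots,T_4$ are the convex hulls of * $T_1$: $(\pm1,0,\pm1),\ (0,\pm\tau,\pm\tau)$ (all sign choices); * $T_2$: $(\pm\tau^2,0,0),\ (0,\pm1,\tau)$; * $T_3$: $(0,0,0),\ (2\tau,0,0),\ (\tau,\tau^2,\pm1),\ (\tau^2,1,\pm\tau)$; * $T_4$: $(0,0,0),\ (2\tau,0,0),\ (\tau,\tau^2,\pm1),\ (\tau^2,1,-\tau),\ (\tau,\tau-1,1)$. Write $T_i^{(n)}=\tau^nT_i$ for the tile inflated by the factor $\tau^n$ (so $T_i^{(0)}=T_i$), and let $d(\tau^n)$ be the solid regular dodecahedron of edge length $\tau^n$. For solids $A,S_1,\dots,S_k$ and nonnegative integers $m_1,\dots,m_k$, the formula $A=m_1S_1+\dots+m_kS_k$ means that $A$ is a union of $m_1+\dots+m_k$ solids with pairwise disjoint interiors, $m_j$ of which are congruent copies of $S_j$ for each $j$ (mirror images count as congruent). **Theorem.** 1. The following dissections exist: $$\begin{aligned} T_1^{(2)}&=d(1)+2T_2^{(1)}+T_3^{(1)}+T_4^{(1)}+T_2+4T_3,\\ T_2^{(3)}&=d(1)+2T_2^{(2)}+5T_2+6T_3,\\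 T_3^{(2)}&=d(1)+5T_2+6T_3,\\ T_4^{(2)}&=d(1)+3T_2+5T_3,\\ T_2^{(4)}&=2d(1)+d(\tau)+4T_2^{(2)}+5T_2^{(1)}+6T_3^{(1)}+10T_2+12T_3,\\ T_1^{(4)}&=13d(1)+2d(\tau)+9T_2^{(2)}+14T_2^{(1)}+14T_3^{(1)}+3T_4^{(1)}+45T_2+68T_3. \end{aligned}$$ 2. For every $i\in\{1,2,3,4\}$ and every $n\ge4$ there is a dissection $T_i^{(n)}=a\,d(1)+b\,d(\tau)+c_1T_1+c_2T_2+c_3T_3+c_4T_4$ with integers $a,b\ge1$ and $c_j\ge0$, not all $c_j$ zero. 3. For every $n\ge2$ there is a dissection $d(\tau^n)=a\,d(1)+b\,d(\tau)+c_1T_1+c_2T_2+c_3T_3+c_4T_4$ with integers $a\ge1$ and $b,c_j\ge0$, not all $c_j$ zero; here $b\ge1$ if $n\ge3$, and for $n=2$ one may take $a=7$, $b=0$. 4. In particular there is a dissection $$d(\tau^{10})=432139\,d(1)+92850\,d(\tau)+1064050\,T_1+6341550\,T_2+4720730\,T_3+1064050\,T_4 .$$ -/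

import Mathlib

open scoped Pointwise

/-- The golden ratio `(1 + √5) / 2`. -/
local notation "τ" => Real.goldenRatio

/-- Euclidean three-space. -/
abbrev Space : Type := EuclideanSpace ℝ (Fin 3)

/-- The point with coordinates `(x / 2, y / 2, z / 2)`. -/
noncomputable def halfPt (x y z : ℝ) : Space := !₂[x / 2, y / 2, z / 2]

/-- The (solid) tetrahedron with the given vertices. -/
def tet (a b c d : Space) : Set Space := convexHull ℝ {a, b, c, d}

/-- Labels of the four composite tiles. -/
inductive Tile where
  | T₁ : Tile
  | T₂ : Tile
  | T₃ : Tile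
  | T₄ : Tile

/-- The tile `T₁ = E + C` with `E = t₄ + t₁ + t₄` and `C = t₃ + t₆ + t₃`. The tetrahedra below are,
in this order, `t₁`, `t₄`, `t₄` (composing `E`; the two `t₄` are glued to the two equilateral faces
of `t₁`) and `t₆`, `t₃`, `t₃` (composing `C`; the two `t₃` are glued to the two equilateral faces
of `t₆`). The solid `C` sits between the legs of `E`. -/
noncomputable def solidT₁ : Set Space :=
  tet (halfPt (-1) 0 1) (halfPt 1 0 1) (halfPt 0 (-τ) τ) (halfPt 0 τ τ) ∪
  tet (halfPt (-1) 0 1) (halfPt 1 0 1) (halfPt 0 (-τ) τ) (halfPt 0 (-τ) (-τ)) ∪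
  tet (halfPt (-1) 0 1) (halfPt 1 0 1) (halfPt 0 τ τ) (halfPt 0 τ (-τ)) ∪
  tet (halfPt (-1) 0 1) (halfPt 1 0 1) (halfPt 0 (-τ) (-τ)) (halfPt 0 τ (-τ)) ∪
  tet (halfPt 0 (-τ) (-τ)) (halfPt 0 τ (-τ)) (halfPt (-1) 0 1) (halfPt (-1) 0 (-1)) ∪
  tet (halfPt 0 (-τ) (-τ)) (halfPt 0 τ (-τ)) (halfPt 1 0 1) (halfPt 1 0 (-1))

/-- The tile `T₂ = t₂ + t₄`, glued along an equilateral face of edge length `1`. -/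
noncomputable def solidT₂ : Set Space :=
  tet (halfPt (1 - τ) 0 0) (halfPt 0 1 τ) (halfPt 0 (-1) τ) (halfPt (-τ ^ 2) 0 0) ∪
  tet (halfPt (1 - τ) 0 0) (halfPt 0 1 τ) (halfPt 0 (-1) τ) (halfPt (τ ^ 2) 0 0)

/-- The tile `T₃ = t₅ + t₆ + t₅`: the tetrahedra below are `t₆`, `t₅`, `t₅`, the two `t₅` being
glued to the two equilateral faces of `t₆` so that the result is a pyramid over a regular pentagon
of edge length `1`, with apex at the origin. -/
noncomputable def solidT₃ : Set Space :=
  tet (halfPt 0 0 0) (halfPt (2 * τ) 0 0) (halfPt τ (τ ^ 2) (-1)) (halfPt τ (τ ^ 2) 1) ∪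
  tet (halfPt 0 0 0) (halfPt (2 * τ) 0 0) (halfPt τ (τ ^ 2) (-1)) (halfPt (τ ^ 2) 1 (-τ)) ∪
  tet (halfPt 0 0 0) (halfPt (2 * τ) 0 0) (halfPt τ (τ ^ 2) 1) (halfPt (τ ^ 2) 1 τ)

/-- The tile `T₄ = t₃ + t₆ + t₅`, obtained from `T₃` by replacing one of the two `t₅` by `t₃`. The
tetrahedra below are `t₆`, `t₅`, `t₃`. -/
noncomputable def solidT₄ : Set Space :=
  tet (halfPt 0 0 0) (halfPt (2 * τ) 0 0) (halfPt τ (τ ^ 2) (-1)) (halfPt τ (τ ^ 2) 1) ∪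
  tet (halfPt 0 0 0) (halfPt (2 * τ) 0 0) (halfPt τ (τ ^ 2) (-1)) (halfPt (τ ^ 2) 1 (-τ)) ∪
  tet (halfPt 0 0 0) (halfPt (2 * τ) 0 0) (halfPt τ (τ ^ 2) 1) (halfPt τ (τ - 1) 1)

/-- The composite tile with a given label. -/
noncomputable def Tile.solid : Tile → Set Space
  | .T₁ => solidT₁
  | .T₂ => solidT₂
  | .T₃ => solidT₃
  | .T₄ => solidT₄

/-- The inflated tile `T_i^{(n)} = τⁿ T_i`. -/
noncomputable def Tile.infl (i : Tile) (n : ℕ) : Set Space := (τ ^ n) • i.solid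

/-- The twenty vertices of the regular dodecahedron of edge length `1` centred at the origin. -/
noncomputable def dodVertices : Set Space :=
  {v | ∃ r ∈ ({1, -1} : Set ℝ), ∃ s ∈ ({1, -1} : Set ℝ), ∃ t ∈ ({1, -1} : Set ℝ),
    v = halfPt (r * τ) (s * τ) (t * τ) ∨ v = halfPt 0 r (s * τ ^ 2) ∨
    v = halfPt r (s * τ ^ 2) 0 ∨ v = halfPt (s * τ ^ 2) 0 r}

/-- `dod n` is `d(τⁿ)`, the solid regular dodecahedron of edge length `τⁿ`. -/
noncomputable def dod (n : ℕ) : Set Space := (τ ^ n) • convexHull ℝ dodVertices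

/-- `Dissects A S`: the solid `A` is the union of finitely many pieces with pairwise disjoint
interiors, the pieces being congruent (by isometries of space) to the members of the multiset `S`,
each member being used as often as its multiplicity says. This is the meaning of the tile content
formula `A = n₁ S₁ + ⋯ + n_k S_k`. -/
def Dissects (A : Set Space) (S : Multiset (Set Space)) : Prop :=
  ∃ (m : ℕ) (proto piece : Fin m → Set Space),
    Multiset.ofList (List.ofFn proto) = S ∧
    (∀ k, ∃ e : Space ≃ᵢ Space, piece k = e '' proto k) ∧
    A = ⋃ k, piece k ∧
    Pairwise fun k l => Disjoint (interior (piece k)) (interior (piece l))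

/-- `a` dodecahedra `d(1)`, `b` dodecahedra `d(τ)` and `c i` composite tiles of each type `i`. -/
noncomputable def dodContent (a b : ℕ) (c : Tile → ℕ) : Multiset (Set Space) :=
  a • {dod 0} + b • {dod 1} +
    c .T₁ • {Tile.infl .T₁ 0} + c .T₂ • {Tile.infl .T₂ 0} +
    c .T₃ • {Tile.infl .T₃ 0} + c .T₄ • {Tile.infl .T₄ 0}

open Tile

/-! In suitable units all vertices lie in ℤ[τ]³, and every facet of the four tiles is parallel to a
face of one fixed regular dodecahedron. A proposed dissection of a convex solid is then a finite
certificate: a rigid motion for each piece and a short list of planes. Three things suffice: each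
piece lies in the solid, any two pieces lie on opposite sides of a listed plane, and the volumes add
up. The uncovered part of the interior is then open and null, hence empty (`eq_iUnion_of_volume`).
All three conditions are sign computations in ℤ[τ], evaluated by the kernel
(`dissectsInto_of_check`).

Each solid is needed both as a convex hull and as an intersection of half-spaces, together with its
volume up to a common factor. A binary space partition into tetrahedra (`BSP`) supplies all of this.

Eight dissections are certified directly: the tiles of order one, d(1) = 3T₁ + 4T₂ + 4T₄, and T₁,
T₃, T₄ at order two with one dodecahedron d(1) each. The rest is formal. Dissections can be dilated
(`Dissects.smul`) and substituted into one another (`DissectsInto.sum_map`), so numbers of pieces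
obey a linear recursion (`contents`). For all large orders, the order-one rules reduce a tile of
order n + 1 to tiles of order n, so that the presence of both dodecahedra at order four persists,
and d(τⁿ) inherits it from the tiles of order n. -/

/-! ### Exact arithmetic and signs in ℤ[τ]. -/

/-- The golden integer `re + im * τ`. -/
structure GInt where
  re : ℤ
  im : ℤ
deriving DecidableEq

namespace GInt

/-- The real number represented by a golden integer. -/
noncomputable def val (z : GInt) : ℝ := z.re + z.im * τ

instance : Add GInt := ⟨fun z w => ⟨z.re + w.re, z.im + w.im⟩⟩
instance : Neg GInt := ⟨fun z => ⟨-z.re, -z.im⟩⟩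
instance : Sub GInt := ⟨fun z w => ⟨z.re - w.re, z.im - w.im⟩⟩
instance : Mul GInt :=
  ⟨fun z w => ⟨z.re * w.re + z.im * w.im, z.re * w.im + z.im * w.re + z.im * w.im⟩⟩
instance (n : ℕ) : OfNat GInt n := ⟨⟨n, 0⟩⟩

/-- The golden ratio. -/
def φ : GInt := ⟨0, 1⟩

/-- The inverse of the golden ratio. -/
def ψ : GInt := ⟨-1, 1⟩

/-- The powers of the golden ratio. -/
def φpow : ℕ → GInt
  | 0 => 1
  | n + 1 => φ * φpow n

@[simp] theorem val_add (z w : GInt) : (z + w).val = z.val + w.val := by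
  change ((z.re + w.re : ℤ) : ℝ) + ((z.im + w.im : ℤ) : ℝ) * τ = _
  simp only [val]; push_cast; ring

@[simp] theorem val_neg (z : GInt) : (-z).val = -z.val := by
  change ((-z.re : ℤ) : ℝ) + ((-z.im : ℤ) : ℝ) * τ = _
  simp only [val]; push_cast; ring

@[simp] theorem val_sub (z w : GInt) : (z - w).val = z.val - w.val := by
  change ((z.re - w.re : ℤ) : ℝ) + ((z.im - w.im : ℤ) : ℝ) * τ = _
  simp only [val]; push_cast; ring

@[simp] theorem val_mul (z w : GInt) : (z * w).val = z.val * w.val := by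
  change ((z.re * w.re + z.im * w.im : ℤ) : ℝ) +
    ((z.re * w.im + z.im * w.re + z.im * w.im : ℤ) : ℝ) * τ = _
  simp only [val]; push_cast
  linear_combination (-(z.im * w.im : ℝ)) * Real.goldenRatio_sq

@[simp] theorem val_ofNat (n : ℕ) : (OfNat.ofNat n : GInt).val = n := by
  change (((n : ℕ) : ℤ) : ℝ) + ((0 : ℤ) : ℝ) * τ = _
  push_cast; ring

@[simp] theorem val_φ : φ.val = τ := by simp [val, φ]

@[simp] theorem val_ψ : ψ.val = τ - 1 := by simp [val, ψ]; ring

@[simp] theorem val_φpow (n : ℕ) : (φpow n).val = τ ^ n := by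
  induction n with
  | zero => exact (val_ofNat 1).trans (by simp)
  | succ n ih => rw [φpow, val_mul, ih, val_φ, pow_succ']

/-- A decision procedure for positivity: `2 * z = (2 * re + im) + im * √5`. -/
def isPos (z : GInt) : Bool :=
  (decide (0 < 2 * z.re + z.im) &&
    (decide (0 ≤ z.im) || decide (5 * (z.im * z.im) < (2 * z.re + z.im) * (2 * z.re + z.im)))) ||
  (decide (0 < z.im) &&
    (decide (0 ≤ 2 * z.re + z.im) ||
      decide ((2 * z.re + z.im) * (2 * z.re + z.im) < 5 * (z.im * z.im))))

/-- A decision procedure for nonnegativity. -/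
def isNonneg (z : GInt) : Bool := decide (z = 0) || z.isPos

/-- After doubling, the number is p + q√5 with integers p, q; if their signs differ, comparing p²
with 5q² decides. Only soundness is needed: a wrong `false` could merely make a certificate fail. -/
theorem val_pos_of_isPos {z : GInt} (h : z.isPos = true) : 0 < z.val := by
  have h5 : (0 : ℝ) < √5 := by positivity
  have hs : √5 * √5 = 5 := Real.mul_self_sqrt (by norm_num)
  have hz : 2 * z.val = ((2 * z.re + z.im : ℤ) : ℝ) + z.im * √5 := by
    simp only [val, Real.goldenRatio]; push_cast; ring
  suffices 0 < ((2 * z.re + z.im : ℤ) : ℝ) + z.im * √5 by linarith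
  simp only [isPos, Bool.or_eq_true, Bool.and_eq_true, decide_eq_true_eq] at h
  generalize 2 * z.re + z.im = p at h ⊢
  generalize z.im = q at h ⊢
  rcases h with ⟨hp, hq | hq⟩ | ⟨hq, hp | hp⟩
  · have hp' : (0 : ℝ) < p := by exact_mod_cast hp
    have hq' : (0 : ℝ) ≤ q := by exact_mod_cast hq
    positivity
  · have hp' : (0 : ℝ) < p := by exact_mod_cast hp
    have hq' : (5 * (q * q) : ℝ) < p * p := by exact_mod_cast hq
    by_contra hc
    nlinarith [mul_self_nonneg (p + q * √5)]
  · have hp' : (0 : ℝ) ≤ p := by exact_mod_cast hp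
    have hq' : (0 : ℝ) < q := by exact_mod_cast hq
    positivity
  · have hq' : (0 : ℝ) < q := by exact_mod_cast hq
    have hp' : (p * p : ℝ) < 5 * (q * q) := by exact_mod_cast hp
    have := mul_pos hq' h5
    by_contra hc
    nlinarith

theorem val_nonneg_of_isNonneg {z : GInt} (h : z.isNonneg = true) : 0 ≤ z.val := by
  simp only [isNonneg, Bool.or_eq_true, decide_eq_true_eq] at h
  rcases h with rfl | h
  · exact ((val_ofNat 0).trans (by simp)).ge
  · exact (val_pos_of_isPos h).le

theorem val_zero : (0 : GInt).val = 0 := (val_ofNat 0).trans (by simp)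
theorem val_one : (1 : GInt).val = 1 := (val_ofNat 1).trans (by simp)
theorem val_two : (2 : GInt).val = 2 := (val_ofNat 2).trans (by simp)

/-- The absolute value. -/
def abs (z : GInt) : GInt := if z.isNonneg then z else -z

/-- `isNonneg` is only known to be sound, so nothing follows from its failure for z. The hypothesis
on the computed result makes up for this in the branch where z is negated. -/
theorem val_abs_of_check {z : GInt} (h : z.abs.isNonneg = true) : z.abs.val = |z.val| := by
  have h0 := val_nonneg_of_isNonneg h
  unfold abs at h0 ⊢
  split_ifs at h0 ⊢ with hz
  · exact (abs_of_nonneg h0).symm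
  · rw [val_neg] at h0 ⊢
    exact (abs_of_nonpos (by linarith)).symm

end GInt

open GInt

/-! ### Points, planes and convex polyhedra with golden coordinates. -/

/-- A triple of golden integers, used for points and for normal vectors. -/
structure GVec where
  x : GInt
  y : GInt
  z : GInt
deriving DecidableEq

namespace GVec

/-- The point of space with the given coordinates. -/
noncomputable def toSpace (p : GVec) : Space := !₂[p.x.val, p.y.val, p.z.val]

instance : Add GVec := ⟨fun p q => ⟨p.x + q.x, p.y + q.y, p.z + q.z⟩⟩
instance : Sub GVec := ⟨fun p q => ⟨p.x - q.x, p.y - q.y, p.z - q.z⟩⟩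
instance : Neg GVec := ⟨fun p => ⟨-p.x, -p.y, -p.z⟩⟩

/-- The scalar product. -/
def dot (p q : GVec) : GInt := p.x * q.x + p.y * q.y + p.z * q.z

/-- The multiple of a vector by a golden integer. -/
def scale (c : GInt) (p : GVec) : GVec := ⟨c * p.x, c * p.y, c * p.z⟩

/-- The determinant of three vectors. -/
def det (p q r : GVec) : GInt :=
  p.x * (q.y * r.z - q.z * r.y) - p.y * (q.x * r.z - q.z * r.x) + p.z * (q.x * r.y - q.y * r.x)

theorem half_smul_toSpace (p : GVec) :
    (1 / 2 : ℝ) • p.toSpace = halfPt p.x.val p.y.val p.z.val := by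
  ext i; fin_cases i <;> simp [toSpace, halfPt] <;> ring

theorem toSpace_scale (c : GInt) (p : GVec) : (p.scale c).toSpace = c.val • p.toSpace := by
  ext i; fin_cases i <;> simp [toSpace, scale]

theorem toSpace_sub (p q : GVec) : (p - q).toSpace = p.toSpace - q.toSpace := by
  ext i
  fin_cases i
  exacts [val_sub p.x q.x, val_sub p.y q.y, val_sub p.z q.z]

end GVec

/-- An oriented plane, given by a normal vector and a constant. -/
structure GPlane where
  normal : GVec
  const : GInt

namespace GPlane

/-- The value of the affine functional of a plane at a point. -/
def eval (g : GPlane) (p : GVec) : GInt := g.normal.dot p + g.const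

/-- The same plane with the opposite orientation. -/
def flip (g : GPlane) : GPlane := ⟨-g.normal, -g.const⟩

/-- The affine functional of a plane, with coordinates in units of length `u`. -/
noncomputable def aff (g : GPlane) (u : ℝ) : Space →ᵃ[ℝ] ℝ :=
  (g.normal.x.val • (EuclideanSpace.proj 0 : Space →L[ℝ] ℝ).toLinearMap +
    g.normal.y.val • (EuclideanSpace.proj 1 : Space →L[ℝ] ℝ).toLinearMap +
    g.normal.z.val • (EuclideanSpace.proj 2 : Space →L[ℝ] ℝ).toLinearMap).toAffineMap +
    AffineMap.const ℝ Space (u * g.const.val)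

theorem aff_apply (g : GPlane) (u : ℝ) (x : Space) :
    g.aff u x = g.normal.x.val * x 0 + g.normal.y.val * x 1 + g.normal.z.val * x 2 +
      u * g.const.val := by
  simp [aff]

theorem aff_smul_toSpace (g : GPlane) (u : ℝ) (p : GVec) :
    g.aff u (u • p.toSpace) = u * (g.eval p).val := by
  simp [aff_apply, GVec.toSpace, eval, GVec.dot]; ring

theorem aff_flip (g : GPlane) (u : ℝ) (x : Space) : g.flip.aff u x = -g.aff u x := by
  have h1 : g.flip.normal.x.val = -g.normal.x.val := val_neg _
  have h2 : g.flip.normal.y.val = -g.normal.y.val := val_neg _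
  have h3 : g.flip.normal.z.val = -g.normal.z.val := val_neg _
  have h4 : g.flip.const.val = -g.const.val := val_neg _
  rw [aff_apply, aff_apply, h1, h2, h3, h4]; ring

theorem continuous_aff (g : GPlane) (u : ℝ) : Continuous (g.aff u) := by
  simp only [funext (g.aff_apply u)]
  fun_prop

end GPlane

/-- The convex hull of a list of points, with coordinates in units of length `u`. -/
noncomputable def ghull (u : ℝ) (V : List GVec) : Set Space :=
  convexHull ℝ ((fun p : GVec => u • p.toSpace) '' {p | p ∈ V})

/-- The convex polyhedron cut out by a list of planes. -/
def gpoly (u : ℝ) (H : List GPlane) : Set Space := {x | ∀ g ∈ H, 0 ≤ g.aff u x}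

theorem ghull_subset_halfspace {u : ℝ} (hu : 0 ≤ u) {V : List GVec} {g : GPlane}
    (h : ∀ p ∈ V, (g.eval p).isNonneg = true) : ghull u V ⊆ {x | 0 ≤ g.aff u x} := by
  have hc : Convex ℝ {x | 0 ≤ g.aff u x} := (convex_Ici (0 : ℝ)).affine_preimage (g.aff u)
  refine convexHull_min ?_ hc
  rintro _ ⟨p, hp, rfl⟩
  change 0 ≤ g.aff u _
  rw [GPlane.aff_smul_toSpace]
  exact mul_nonneg hu (val_nonneg_of_isNonneg (h p hp))

theorem isCompact_ghull (u : ℝ) (V : List GVec) : IsCompact (ghull u V) :=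
  (V.finite_toSet.image _).isCompact_convexHull ℝ

theorem convex_ghull (u : ℝ) (V : List GVec) : Convex ℝ (ghull u V) := convex_convexHull ℝ _

theorem convex_gpoly (u : ℝ) (H : List GPlane) : Convex ℝ (gpoly u H) := by
  have : gpoly u H = ⋂ g ∈ H, {x | 0 ≤ g.aff u x} := by ext; simp [gpoly]
  rw [this]
  exact convex_iInter₂ fun g _ => (convex_Ici (0 : ℝ)).affine_preimage (g.aff u)

theorem isClosed_gpoly (u : ℝ) (H : List GPlane) : IsClosed (gpoly u H) := by
  have : gpoly u H = ⋂ g ∈ H, {x | 0 ≤ g.aff u x} := by ext; simp [gpoly]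
  rw [this]
  exact isClosed_biInter fun g _ => isClosed_Ici.preimage (g.continuous_aff u)

/-- The tetrahedron with vertices given by golden integers, in units of half the short edge. -/
noncomputable def gtet (q : GVec × GVec × GVec × GVec) : Set Space :=
  tet ((1 / 2 : ℝ) • q.1.toSpace) ((1 / 2 : ℝ) • q.2.1.toSpace) ((1 / 2 : ℝ) • q.2.2.1.toSpace)
    ((1 / 2 : ℝ) • q.2.2.2.toSpace)

/-! ### Tetrahedra: half-spaces, volume and separation. -/

open MeasureTheory

theorem tet_eq_convexHull_range (v : Fin 4 → Space) :
    tet (v 0) (v 1) (v 2) (v 3) = convexHull ℝ (Set.range v) := by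
  unfold tet
  congr 1
  ext x
  simp only [Set.mem_insert_iff, Set.mem_singleton_iff, Set.mem_range]
  constructor
  · rintro (rfl | rfl | rfl | rfl)
    exacts [⟨0, rfl⟩, ⟨1, rfl⟩, ⟨2, rfl⟩, ⟨3, rfl⟩]
  · rintro ⟨i, rfl⟩
    fin_cases i
    exacts [Or.inl rfl, Or.inr (Or.inl rfl), Or.inr (Or.inr (Or.inl rfl)),
      Or.inr (Or.inr (Or.inr rfl))]

/-- Four points for which there are affine functionals, each vanishing at three of the points and
positive at the fourth, are affinely independent. -/
theorem affineIndependent_of_dual {v : Fin 4 → Space} {g : Fin 4 → Space →ᵃ[ℝ] ℝ}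
    (h0 : ∀ i j, i ≠ j → g i (v j) = 0) (h1 : ∀ i, 0 < g i (v i)) : AffineIndependent ℝ v := by
  rw [affineIndependent_iff]
  intro s w hw hv i hi
  have key : ∀ x, g i x = (g i).linear x + g i 0 := fun x => by
    have := (g i).map_vadd 0 x
    rwa [vadd_eq_add, vadd_eq_add, add_zero] at this
  -- Apply g i to the vanishing combination; its constant term drops out because the weights sum to
  -- zero.
  have hsum : ∑ e ∈ s, w e * g i (v e) = 0 := by
    rw [Finset.sum_congr rfl fun e _ => congrArg (w e * ·) (key (v e))]
    simp_rw [mul_add, Finset.sum_add_distrib, ← Finset.sum_mul, hw, zero_mul, add_zero]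
    have := congrArg (g i).linear hv
    simpa only [map_sum, map_smul, map_zero, smul_eq_mul] using this
  rw [Finset.sum_eq_single_of_mem i hi (fun j _ hj => by rw [h0 i j hj.symm, mul_zero])] at hsum
  exact (mul_eq_zero.mp hsum).resolve_right (h1 i).ne'

/-- A tetrahedron is the intersection of four half-spaces, and has interior points. -/
theorem mem_tet_of_dual {v : Fin 4 → Space} {g : Fin 4 → Space →ᵃ[ℝ] ℝ}
    (h0 : ∀ i j, i ≠ j → g i (v j) = 0) (h1 : ∀ i, 0 < g i (v i)) :
    (∀ x, (∀ i, 0 ≤ g i x) → x ∈ tet (v 0) (v 1) (v 2) (v 3)) ∧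
      (interior (tet (v 0) (v 1) (v 2) (v 3))).Nonempty := by
  have hi := affineIndependent_of_dual h0 h1
  have ht : affineSpan ℝ (Set.range v) = ⊤ := by
    rw [hi.affineSpan_eq_top_iff_card_eq_finrank_add_one]
    simp
  let b : AffineBasis (Fin 4) ℝ Space := ⟨v, hi, ht⟩
  rw [tet_eq_convexHull_range]
  refine ⟨fun x hx => ?_, ⟨_, b.centroid_mem_interior_convexHull⟩⟩
  have hb : x ∈ convexHull ℝ (Set.range b) := by
    rw [b.convexHull_eq_nonneg_coord]
    intro i
    -- An affine function vanishing at all vertices but one is a multiple of the barycentric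
    -- coordinate of that vertex.
    have hgi : g i x = b.coord i x * g i (v i) := by
      conv_lhs => rw [← b.affineCombination_coord_eq_self x]
      rw [Finset.map_affineCombination _ _ _ (b.sum_coord_apply_eq_one x)]
      rw [Finset.affineCombination_eq_linear_combination _ _ _ (b.sum_coord_apply_eq_one x)]
      rw [Finset.sum_eq_single i]
      · rfl
      · intro j _ hj
        simp only [Function.comp_apply, smul_eq_mul]
        exact mul_eq_zero_of_right _ (h0 i j hj.symm)
      · simp
    by_contra hneg
    have := mul_neg_of_neg_of_pos (not_le.mp hneg) (h1 i)
    have := hx i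
    linarith
  exact hb

/-- The volume of a fixed reference tetrahedron. -/
noncomputable def tetUnit : ENNReal :=
  volume (tet 0 ((1 / 2 : ℝ) • EuclideanSpace.single 0 1) ((1 / 2 : ℝ) • EuclideanSpace.single 1 1)
    ((1 / 2 : ℝ) • EuclideanSpace.single 2 1))

/-- Six times the volume of a tetrahedron in suitable units. -/
def tetDet (q : GVec × GVec × GVec × GVec) : GInt :=
  (GVec.det (q.2.1 - q.1) (q.2.2.1 - q.1) (q.2.2.2 - q.1)).abs

theorem tet_image (f : Space →ᵃ[ℝ] Space) (a b c d : Space) :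
    f '' tet a b c d = tet (f a) (f b) (f c) (f d) := by
  simp [tet, AffineMap.image_convexHull, Set.image_insert_eq]

/-- The tetrahedron is an affine image of the reference one, so its volume scales by |det|. The
value of `tetUnit` is irrelevant, since volumes are only compared with each other. -/
theorem volume_gtet (q : GVec × GVec × GVec × GVec) (h : (tetDet q).isNonneg = true) :
    volume (gtet q) = ENNReal.ofReal (tetDet q).val * tetUnit := by
  obtain ⟨a, b, c, d⟩ := q
  let M : Matrix (Fin 3) (Fin 3) ℝ := !![(b - a).x.val, (c - a).x.val, (d - a).x.val;
    (b - a).y.val, (c - a).y.val, (d - a).y.val; (b - a).z.val, (c - a).z.val, (d - a).z.val]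
  let L : Space →ₗ[ℝ] Space := Matrix.toEuclideanLin M
  have hdet : LinearMap.det L = (GVec.det (b - a) (c - a) (d - a)).val := by
    have : LinearMap.det L = M.det := by
      simp only [L, Matrix.toLpLin_eq_toLin]
      exact LinearMap.det_toLin _ _
    rw [this]
    simp only [M, Matrix.det_fin_three, GVec.det, val_add, val_sub, val_mul]
    simp
    ring
  have hcol : ∀ p q r : GVec, ∀ M : Matrix (Fin 3) (Fin 3) ℝ,
      M = !![p.x.val, q.x.val, r.x.val; p.y.val, q.y.val, r.y.val; p.z.val, q.z.val, r.z.val] →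
      Matrix.toEuclideanLin M (EuclideanSpace.single 0 1) = p.toSpace ∧
      Matrix.toEuclideanLin M (EuclideanSpace.single 1 1) = q.toSpace ∧
      Matrix.toEuclideanLin M (EuclideanSpace.single 2 1) = r.toSpace := by
    rintro p q r M rfl
    refine ⟨?_, ?_, ?_⟩ <;> ext i <;> fin_cases i <;>
      simp [GVec.toSpace, Matrix.toLpLin_apply]
  obtain ⟨hb, hc, hd⟩ := hcol (b - a) (c - a) (d - a) M rfl
  have himg : gtet (a, b, c, d) = (fun x => (1 / 2 : ℝ) • a.toSpace + x) ''
      (L '' tet 0 ((1 / 2 : ℝ) • EuclideanSpace.single 0 1)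
        ((1 / 2 : ℝ) • EuclideanSpace.single 1 1) ((1 / 2 : ℝ) • EuclideanSpace.single 2 1)) := by
    have h1 := tet_image L.toAffineMap 0 ((1 / 2 : ℝ) • EuclideanSpace.single 0 1)
        ((1 / 2 : ℝ) • EuclideanSpace.single 1 1) ((1 / 2 : ℝ) • EuclideanSpace.single 2 1)
    have h2 := tet_image (AffineMap.const ℝ Space ((1 / 2 : ℝ) • a.toSpace) + AffineMap.id ℝ Space)
    simp only [LinearMap.coe_toAffineMap] at h1
    rw [h1]
    have h3 := h2 (L 0) (L ((1 / 2 : ℝ) • EuclideanSpace.single 0 1))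
        (L ((1 / 2 : ℝ) • EuclideanSpace.single 1 1)) (L ((1 / 2 : ℝ) • EuclideanSpace.single 2 1))
    refine Eq.trans ?_ h3.symm
    simp only [L, map_smul, hb, hc, hd, map_zero, GVec.toSpace_sub, gtet]
    congr 1 <;> simp [smul_sub]
  rw [himg, Set.image_add_left, measure_preimage_add, Measure.addHaar_image_linearMap, hdet,
    tetDet, val_abs_of_check h]
  rfl

/-- At a common interior point the functional is ≤ 0. A small move against the normal stays in P but
makes the functional strictly negative, the normal being nonzero. -/
theorem disjoint_interior_of_separated {u : ℝ} {g : GPlane} {P Q : Set Space}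
    (hn : (g.normal.dot g.normal).isPos = true) (hP : P ⊆ {x | 0 ≤ g.aff u x})
    (hQ : Q ⊆ {x | 0 ≤ g.flip.aff u x}) : Disjoint (interior P) (interior Q) := by
  rw [Set.disjoint_left]
  intro x hxP hxQ
  have hQx : g.aff u x ≤ 0 := by
    have : 0 ≤ g.flip.aff u x := hQ (interior_subset hxQ)
    rw [GPlane.aff_flip] at this
    linarith
  have hcont : Continuous fun s : ℝ => x - s • g.normal.toSpace := by fun_prop
  have hev : ∀ᶠ s : ℝ in nhds 0, x - s • g.normal.toSpace ∈ interior P := by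
    refine hcont.continuousAt.eventually_mem ?_
    simpa using isOpen_interior.mem_nhds hxP
  obtain ⟨ε, hε, hball⟩ := Metric.eventually_nhds_iff.mp hev
  have hmem : 0 ≤ g.aff u (x - (ε / 2) • g.normal.toSpace) := by
    refine hP (interior_subset (hball ?_))
    rw [Real.dist_eq, sub_zero, abs_of_pos (by positivity)]
    linarith
  have hval : g.aff u (x - (ε / 2) • g.normal.toSpace) =
      g.aff u x - ε / 2 * (g.normal.dot g.normal).val := by
    simp [GPlane.aff_apply, GVec.toSpace, GVec.dot]; ring
  have := mul_pos (half_pos hε) (val_pos_of_isPos hn)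
  linarith

/-- A common point is a frontier point of one of the sets, and frontiers of convex sets are null. -/
theorem aedisjoint_of_convex {P Q : Set Space} (hP : Convex ℝ P) (hQ : Convex ℝ Q)
    (h : Disjoint (interior P) (interior Q)) : AEDisjoint volume P Q := by
  have hsub : P ∩ Q ⊆ frontier P ∪ frontier Q := by
    rintro x ⟨hxP, hxQ⟩
    by_contra hx
    rw [Set.mem_union, not_or] at hx
    have hp : x ∈ interior P := by
      by_contra hc
      exact hx.1 ⟨subset_closure hxP, hc⟩
    have hq : x ∈ interior Q := by
      by_contra hc
      exact hx.2 ⟨subset_closure hxQ, hc⟩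
    exact Set.disjoint_left.mp h hp hq
  exact measure_mono_null hsub (measure_union_null (hP.addHaar_frontier _) (hQ.addHaar_frontier _))

/-! ### Binary space partitions into tetrahedra. -/

/-- A binary space partition with tetrahedral cells. -/
inductive BSP where
  | leaf (q : GVec × GVec × GVec × GVec) : BSP
  | node (g : GPlane) (l r : BSP) : BSP

namespace BSP

/-- Some plane in the list contains the last three points and has the first on its positive side. -/
def hasDual (H : List GPlane) (a b c d : GVec) : Bool :=
  H.any fun g => (g.eval a).isPos && decide (g.eval b = 0) && decide (g.eval c = 0) &&
    decide (g.eval d = 0)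

/-- The vertices of the cells. -/
def cells : BSP → List (GVec × GVec × GVec × GVec)
  | leaf q => [q]
  | node _ l r => l.cells ++ r.cells

/-- The sum of the determinants of the cells. -/
def vol : BSP → GInt
  | leaf q => tetDet q
  | node _ l r => l.vol + r.vol

/-- The cells of the partition are exactly the parts into which its planes divide the polyhedron
cut out by the planes in `H`. -/
def check (H : List GPlane) : BSP → Bool
  | leaf (a, b, c, d) =>
    (tetDet (a, b, c, d)).isNonneg &&
    (H.all fun g => (g.eval a).isNonneg && (g.eval b).isNonneg && (g.eval c).isNonneg &&
      (g.eval d).isNonneg) &&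
    hasDual H a b c d && hasDual H b a c d && hasDual H c a b d && hasDual H d a b c
  | node g l r => (g.normal.dot g.normal).isPos && check (g :: H) l && check (g.flip :: H) r

theorem exists_of_hasDual {H : List GPlane} {a b c d : GVec} (h : hasDual H a b c d = true) :
    ∃ g ∈ H, 0 < g.aff (1 / 2) ((1 / 2 : ℝ) • a.toSpace) ∧
      g.aff (1 / 2) ((1 / 2 : ℝ) • b.toSpace) = 0 ∧
      g.aff (1 / 2) ((1 / 2 : ℝ) • c.toSpace) = 0 ∧
      g.aff (1 / 2) ((1 / 2 : ℝ) • d.toSpace) = 0 := by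
  simp only [hasDual, List.any_eq_true, Bool.and_eq_true, decide_eq_true_eq] at h
  obtain ⟨g, hg, ⟨⟨ha, hb⟩, hc⟩, hd⟩ := h
  refine ⟨g, hg, ?_, ?_, ?_, ?_⟩ <;> rw [GPlane.aff_smul_toSpace]
  · exact mul_pos (by norm_num) (val_pos_of_isPos ha)
  · rw [hb, val_zero, mul_zero]
  · rw [hc, val_zero, mul_zero]
  · rw [hd, val_zero, mul_zero]

/-- Four planes of H, one opposite each vertex, already confine the polyhedron to the tetrahedron;
conversely every plane of H is nonnegative at the four vertices. -/
theorem gpoly_eq_gtet {H : List GPlane} {q : GVec × GVec × GVec × GVec}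
    (h : check H (leaf q) = true) :
    gpoly (1 / 2) H = gtet q ∧ (interior (gtet q)).Nonempty := by
  obtain ⟨a, b, c, d⟩ := q
  simp only [check, Bool.and_eq_true, List.all_eq_true] at h
  obtain ⟨⟨⟨⟨⟨-, hH⟩, ha⟩, hb⟩, hc⟩, hd⟩ := h
  obtain ⟨ga, hga, a1, a2, a3, a4⟩ := exists_of_hasDual ha
  obtain ⟨gb, hgb, b1, b2, b3, b4⟩ := exists_of_hasDual hb
  obtain ⟨gc, hgc, c1, c2, c3, c4⟩ := exists_of_hasDual hc
  obtain ⟨gd, hgd, d1, d2, d3, d4⟩ := exists_of_hasDual hd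
  have key := mem_tet_of_dual
    (v := ![(1 / 2 : ℝ) • a.toSpace, (1 / 2 : ℝ) • b.toSpace, (1 / 2 : ℝ) • c.toSpace,
      (1 / 2 : ℝ) • d.toSpace])
    (g := ![ga.aff (1 / 2), gb.aff (1 / 2), gc.aff (1 / 2), gd.aff (1 / 2)])
    (by
      intro i j hij
      fin_cases i <;> fin_cases j <;> first | exact absurd rfl hij | assumption)
    (by
      intro i
      fin_cases i <;> assumption)
  refine ⟨Set.Subset.antisymm (fun x hx => key.1 x ?_) ?_, key.2⟩
  · intro i
    fin_cases i
    exacts [hx _ hga, hx _ hgb, hx _ hgc, hx _ hgd]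
  · refine convexHull_min ?_ (convex_gpoly _ _)
    intro x hx g hg
    obtain ⟨⟨⟨h1, h2⟩, h3⟩, h4⟩ := hH g hg
    have aux : ∀ p : GVec, (g.eval p).isNonneg = true →
        0 ≤ g.aff (1 / 2) ((1 / 2 : ℝ) • p.toSpace) := fun p hp => by
      rw [GPlane.aff_smul_toSpace]
      exact mul_nonneg (by norm_num) (val_nonneg_of_isNonneg hp)
    rcases hx with rfl | rfl | rfl | rfl
    exacts [aux _ h1, aux _ h2, aux _ h3, aux _ h4]

theorem gpoly_cons (g : GPlane) (H : List GPlane) (u : ℝ) :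
    gpoly u (g :: H) = {x | 0 ≤ g.aff u x} ∩ gpoly u H := by
  ext; simp [gpoly]

theorem gpoly_split (g : GPlane) (H : List GPlane) (u : ℝ) :
    gpoly u H = gpoly u (g :: H) ∪ gpoly u (g.flip :: H) := by
  rw [gpoly_cons, gpoly_cons, ← Set.union_inter_distrib_right]
  refine (Set.inter_eq_right.mpr fun x _ => ?_).symm
  rcases le_total 0 (g.aff u x) with h | h
  · exact Or.inl h
  · refine Or.inr ?_
    change 0 ≤ g.flip.aff u x
    rw [GPlane.aff_flip]
    linarith

theorem gpoly_eq_cells {t : BSP} : ∀ {H : List GPlane}, check H t = true →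
    gpoly (1 / 2) H = {x | ∃ q ∈ t.cells, x ∈ gtet q} := by
  induction t with
  | leaf q =>
    intro H h
    rw [(gpoly_eq_gtet h).1]
    simp [cells]
  | node g l r hl hr =>
    intro H h
    simp only [check, Bool.and_eq_true] at h
    rw [gpoly_split g, hl h.1.2, hr h.2]
    ext x
    simp only [cells, List.mem_append, Set.mem_union, Set.mem_ofPred_eq]
    constructor
    · rintro (⟨q, hq, hx⟩ | ⟨q, hq, hx⟩)
      exacts [⟨q, Or.inl hq, hx⟩, ⟨q, Or.inr hq, hx⟩]
    · rintro ⟨q, hq | hq, hx⟩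
      exacts [Or.inl ⟨q, hq, hx⟩, Or.inr ⟨q, hq, hx⟩]

/-- A single cell is enough, so the descent always goes left. -/
theorem interior_gpoly_nonempty {t : BSP} : ∀ {H : List GPlane}, check H t = true →
    (interior (gpoly (1 / 2) H)).Nonempty := by
  induction t with
  | leaf q =>
    intro H h
    rw [(gpoly_eq_gtet h).1]
    exact (gpoly_eq_gtet h).2
  | node g l r hl hr =>
    intro H h
    simp only [check, Bool.and_eq_true] at h
    refine (hl h.1.2).mono (interior_mono ?_)
    rw [gpoly_cons]
    exact Set.inter_subset_right

/-- Needed because `ENNReal.ofReal` is additive only on nonnegative numbers. -/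
theorem val_vol_nonneg {t : BSP} : ∀ {H : List GPlane}, check H t = true → 0 ≤ t.vol.val := by
  induction t with
  | leaf q =>
    intro H h
    simp only [check, Bool.and_eq_true] at h
    exact val_nonneg_of_isNonneg h.1.1.1.1.1
  | node g l r hl hr =>
    intro H h
    simp only [check, Bool.and_eq_true] at h
    rw [vol, val_add]
    exact add_nonneg (hl h.1.2) (hr h.2)

theorem volume_gpoly {t : BSP} : ∀ {H : List GPlane}, check H t = true →
    volume (gpoly (1 / 2) H) = ENNReal.ofReal t.vol.val * tetUnit := by
  induction t with
  | leaf q =>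
    intro H h
    rw [(gpoly_eq_gtet h).1]
    simp only [check, Bool.and_eq_true] at h
    exact volume_gtet q h.1.1.1.1.1
  | node g l r hl hr =>
    intro H h
    simp only [check, Bool.and_eq_true] at h
    have hd : AEDisjoint volume (gpoly (1 / 2) (g :: H)) (gpoly (1 / 2) (g.flip :: H)) := by
      refine aedisjoint_of_convex (convex_gpoly _ _) (convex_gpoly _ _)
        (disjoint_interior_of_separated (u := 1 / 2) h.1.1 ?_ ?_)
      · rw [gpoly_cons]; exact Set.inter_subset_left
      · rw [gpoly_cons]; exact Set.inter_subset_left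
    rw [gpoly_split g, measure_union₀ (isClosed_gpoly _ _).measurableSet.nullMeasurableSet hd,
      hl h.1.2, hr h.2, vol, val_add,
      ENNReal.ofReal_add (val_vol_nonneg h.1.2) (val_vol_nonneg h.2), add_mul]

end BSP

/-! ### Rigid motions over ℤ[τ]. -/

/-- A rigid motion: twice the rows of an orthogonal matrix, and four times a translation vector. -/
structure Motion where
  r₀ : GVec
  r₁ : GVec
  r₂ : GVec
  t : GVec

namespace Motion

/-- Four times the image under a motion of half a point. -/
def app (m : Motion) (p : GVec) : GVec := ⟨m.r₀.dot p, m.r₁.dot p, m.r₂.dot p⟩ + m.t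

/-- The matrix of a motion is orthogonal. -/
def check (m : Motion) : Bool :=
  decide (m.r₀.x * m.r₀.x + m.r₁.x * m.r₁.x + m.r₂.x * m.r₂.x = 4) &&
  decide (m.r₀.y * m.r₀.y + m.r₁.y * m.r₁.y + m.r₂.y * m.r₂.y = 4) &&
  decide (m.r₀.z * m.r₀.z + m.r₁.z * m.r₁.z + m.r₂.z * m.r₂.z = 4) &&
  decide (m.r₀.x * m.r₀.y + m.r₁.x * m.r₁.y + m.r₂.x * m.r₂.y = 0) &&
  decide (m.r₀.x * m.r₀.z + m.r₁.x * m.r₁.z + m.r₂.x * m.r₂.z = 0) &&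
  decide (m.r₀.y * m.r₀.z + m.r₁.y * m.r₁.z + m.r₂.y * m.r₂.z = 0)

/-- The linear part of a motion. -/
noncomputable def linear (m : Motion) : Space →ₗ[ℝ] Space :=
  Matrix.toEuclideanLin ((1 / 2 : ℝ) • !![m.r₀.x.val, m.r₀.y.val, m.r₀.z.val;
    m.r₁.x.val, m.r₁.y.val, m.r₁.z.val; m.r₂.x.val, m.r₂.y.val, m.r₂.z.val])

theorem linear_apply (m : Motion) (x : Space) : m.linear x =
    !₂[(m.r₀.x.val * x 0 + m.r₀.y.val * x 1 + m.r₀.z.val * x 2) / 2,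
      (m.r₁.x.val * x 0 + m.r₁.y.val * x 1 + m.r₁.z.val * x 2) / 2,
      (m.r₂.x.val * x 0 + m.r₂.y.val * x 1 + m.r₂.z.val * x 2) / 2] := by
  ext i
  fin_cases i <;>
    simp [linear, Matrix.toLpLin_apply, dotProduct,
      Fin.sum_univ_three] <;> ring

/-- The six conditions say that the columns of the doubled matrix are orthogonal of length 2. The
sign of the determinant is left free, so mirror images are admitted. -/
theorem norm_linear {m : Motion} (h : m.check = true) (x : Space) : ‖m.linear x‖ = ‖x‖ := by
  simp only [check, Bool.and_eq_true, decide_eq_true_eq] at h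
  obtain ⟨⟨⟨⟨⟨h1, h2⟩, h3⟩, h4⟩, h5⟩, h6⟩ := h
  have h1 := congrArg val h1
  have h2 := congrArg val h2
  have h3 := congrArg val h3
  have h4 := congrArg val h4
  have h5 := congrArg val h5
  have h6 := congrArg val h6
  have v4 : (4 : GInt).val = 4 := (val_ofNat 4).trans (by simp)
  simp only [val_add, val_mul, val_zero, v4] at h1 h2 h3 h4 h5 h6
  rw [EuclideanSpace.norm_eq, EuclideanSpace.norm_eq, linear_apply]
  congr 1
  simp only [Fin.sum_univ_three, Real.norm_eq_abs, sq_abs]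
  simp
  linear_combination (x 0) ^ 2 / 4 * h1 + (x 1) ^ 2 / 4 * h2 + (x 2) ^ 2 / 4 * h3 +
    (x 0) * (x 1) / 2 * h4 + (x 0) * (x 2) / 2 * h5 + (x 1) * (x 2) / 2 * h6

/-- The linear isometry underlying a motion. -/
noncomputable def isometry {m : Motion} (h : m.check = true) : Space ≃ₗᵢ[ℝ] Space :=
  LinearIsometry.toLinearIsometryEquiv ⟨m.linear, norm_linear h⟩ rfl

/-- A motion as an isometry of space. -/
noncomputable def equiv {m : Motion} (h : m.check = true) : Space ≃ᵢ Space :=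
  (isometry h).toIsometryEquiv.trans (IsometryEquiv.addLeft ((1 / 4 : ℝ) • m.t.toSpace))

theorem equiv_apply {m : Motion} (h : m.check = true) (x : Space) :
    equiv h x = (1 / 4 : ℝ) • m.t.toSpace + m.linear x := rfl

theorem equiv_half_smul {m : Motion} (h : m.check = true) (p : GVec) :
    equiv h ((1 / 2 : ℝ) • p.toSpace) = (1 / 4 : ℝ) • (m.app p).toSpace := by
  have e0 : (m.app p).x = m.r₀.dot p + m.t.x := rfl
  have e1 : (m.app p).y = m.r₁.dot p + m.t.y := rfl
  have e2 : (m.app p).z = m.r₂.dot p + m.t.z := rfl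
  rw [equiv_apply, linear_apply]
  ext i
  fin_cases i <;> simp [GVec.toSpace, e0, e1, e2, GVec.dot] <;> ring

/-- The matrix is stored doubled, so units of 1/2 before the motion become units of 1/4 after it. -/
theorem image_ghull {m : Motion} (h : m.check = true) (V : List GVec) :
    equiv h '' ghull (1 / 2) V = ghull (1 / 4) (V.map m.app) := by
  have h1 := AffineMap.image_convexHull
    (AffineMap.const ℝ Space ((1 / 4 : ℝ) • m.t.toSpace) + m.linear.toAffineMap)
    ((fun p : GVec => (1 / 2 : ℝ) • p.toSpace) '' {p | p ∈ V})
  have h2 : ⇑(AffineMap.const ℝ Space ((1 / 4 : ℝ) • m.t.toSpace) + m.linear.toAffineMap) =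
      equiv h := rfl
  rw [h2, Set.image_image] at h1
  rw [ghull, ghull, h1]
  congr 1
  ext x
  simp only [equiv_half_smul h, Set.mem_image, Set.mem_ofPred_eq, List.mem_map]
  constructor
  · rintro ⟨p, hp, rfl⟩
    exact ⟨_, ⟨p, hp, rfl⟩, rfl⟩
  · rintro ⟨_, ⟨p, hp, rfl⟩, rfl⟩
    exact ⟨p, hp, rfl⟩

theorem volume_image {m : Motion} (h : m.check = true) {S : Set Space} (hS : IsClosed S) :
    volume (equiv h '' S) = volume S := by
  have h1 : equiv h '' S =
      (fun x => (1 / 4 : ℝ) • m.t.toSpace + x) '' ((isometry h).symm ⁻¹' S) := by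
    rw [← LinearIsometryEquiv.image_eq_preimage_symm, Set.image_image]
    rfl
  rw [h1, Set.image_add_left, measure_preimage_add]
  exact (isometry h).symm.measurePreserving.measure_preimage hS.measurableSet.nullMeasurableSet

end Motion

/-! ### The four tiles and the dodecahedron as convex polyhedra. -/

/-- The vertices of the solids, and some more of their points, in units of half the short edge.
The label `none` stands for the dodecahedron. -/
def verts : Option Tile → List GVec
  | some .T₁ => [
      ⟨-1, 0, -1⟩, ⟨-1, 0, 1⟩, ⟨1, 0, -1⟩, ⟨1, 0, 1⟩, ⟨0, -φ, -φ⟩, ⟨0, -φ, φ⟩, ⟨0, φ, -φ⟩,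
      ⟨0, φ, φ⟩, ⟨0, 0, φ⟩, ⟨0, 0, -φ⟩]
  | some .T₂ => [
      ⟨⟨-1, -1⟩, 0, 0⟩, ⟨⟨1, 1⟩, 0, 0⟩, ⟨0, 1, φ⟩, ⟨0, -1, φ⟩, ⟨-ψ, 0, 0⟩]
  | some .T₃ => [
      ⟨0, 0, 0⟩, ⟨⟨0, 2⟩, 0, 0⟩, ⟨φ, ⟨1, 1⟩, -1⟩, ⟨φ, ⟨1, 1⟩, 1⟩, ⟨⟨1, 1⟩, 1, -φ⟩, ⟨⟨1, 1⟩, 1, φ⟩]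
  | some .T₄ => [
      ⟨0, 0, 0⟩, ⟨⟨0, 2⟩, 0, 0⟩, ⟨φ, ⟨1, 1⟩, -1⟩, ⟨φ, ⟨1, 1⟩, 1⟩, ⟨⟨1, 1⟩, 1, -φ⟩, ⟨φ, ψ, 1⟩]
  | none => [
      ⟨φ, φ, φ⟩, ⟨φ, φ, -φ⟩, ⟨0, 1, ⟨1, 1⟩⟩, ⟨1, ⟨1, 1⟩, 0⟩, ⟨⟨1, 1⟩, 0, 1⟩, ⟨φ, -φ, φ⟩,
      ⟨φ, -φ, -φ⟩, ⟨0, 1, ⟨-1, -1⟩⟩, ⟨1, ⟨-1, -1⟩, 0⟩, ⟨⟨-1, -1⟩, 0, 1⟩, ⟨-φ, φ, φ⟩, ⟨-φ, φ, -φ⟩,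
      ⟨0, -1, ⟨1, 1⟩⟩, ⟨-1, ⟨1, 1⟩, 0⟩, ⟨⟨1, 1⟩, 0, -1⟩, ⟨-φ, -φ, φ⟩, ⟨-φ, -φ, -φ⟩,
      ⟨0, -1, ⟨-1, -1⟩⟩, ⟨-1, ⟨-1, -1⟩, 0⟩, ⟨⟨-1, -1⟩, 0, -1⟩]

/-- The facet planes of the solids. -/
def faces : Option Tile → List GPlane
  | some .T₁ => [
      ⟨⟨φ, 1, 0⟩, φ⟩, ⟨⟨φ, -1, 0⟩, φ⟩, ⟨⟨1, 0, φ⟩, ⟨1, 1⟩⟩, ⟨⟨1, 0, -φ⟩, ⟨1, 1⟩⟩,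
      ⟨⟨-φ, 1, 0⟩, φ⟩, ⟨⟨-φ, -1, 0⟩, φ⟩, ⟨⟨-1, 0, φ⟩, ⟨1, 1⟩⟩, ⟨⟨-1, 0, -φ⟩, ⟨1, 1⟩⟩]
  | some .T₂ => [
      ⟨⟨0, -φ, 1⟩, 0⟩, ⟨⟨0, φ, 1⟩, 0⟩, ⟨⟨1, 0, -φ⟩, ⟨1, 1⟩⟩, ⟨⟨-1, 0, -φ⟩, ⟨1, 1⟩⟩]
  | some .T₃ => [
      ⟨⟨0, φ, 1⟩, 0⟩, ⟨⟨0, φ, -1⟩, 0⟩, ⟨⟨φ, -1, 0⟩, 0⟩, ⟨⟨1, 0, φ⟩, 0⟩, ⟨⟨1, 0, -φ⟩, 0⟩,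
      ⟨⟨-φ, -1, 0⟩, ⟨2, 2⟩⟩]
  | some .T₄ => [
      ⟨⟨0, φ, 1⟩, 0⟩, ⟨⟨0, φ, -1⟩, 0⟩, ⟨⟨φ, -1, 0⟩, 0⟩, ⟨⟨1, 0, φ⟩, 0⟩, ⟨⟨1, 0, -φ⟩, 0⟩,
      ⟨⟨-φ, -1, 0⟩, ⟨2, 2⟩⟩, ⟨⟨-1, 0, -φ⟩, ⟨0, 2⟩⟩]
  | none => [
      ⟨⟨-φ, -1, 0⟩, ⟨1, 2⟩⟩, ⟨⟨0, -φ, -1⟩, ⟨1, 2⟩⟩, ⟨⟨-1, 0, -φ⟩, ⟨1, 2⟩⟩, ⟨⟨0, -φ, 1⟩, ⟨1, 2⟩⟩,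
      ⟨⟨-1, 0, φ⟩, ⟨1, 2⟩⟩, ⟨⟨1, 0, -φ⟩, ⟨1, 2⟩⟩, ⟨⟨-φ, 1, 0⟩, ⟨1, 2⟩⟩, ⟨⟨0, φ, -1⟩, ⟨1, 2⟩⟩,
      ⟨⟨0, φ, 1⟩, ⟨1, 2⟩⟩, ⟨⟨1, 0, φ⟩, ⟨1, 2⟩⟩, ⟨⟨φ, -1, 0⟩, ⟨1, 2⟩⟩, ⟨⟨φ, 1, 0⟩, ⟨1, 2⟩⟩]

/-- Partitions of the solids into tetrahedra. -/
def partition : Option Tile → BSP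
  | some .T₁ =>
    (.node ⟨⟨⟨1, 1⟩, 0, 1⟩, φ⟩
      (.node ⟨⟨⟨1, 1⟩, 0, -1⟩, -φ⟩
        (.leaf (⟨0, -φ, -φ⟩, ⟨0, φ, -φ⟩, ⟨1, 0, 1⟩, ⟨1, 0, -1⟩))
        (.node ⟨⟨0, -1, 0⟩, 0⟩
          (.node ⟨⟨0, -1, ⟨-1, -1⟩⟩, ⟨1, 1⟩⟩
            (.node ⟨⟨0, φ, -1⟩, 1⟩
              (.leaf (⟨-1, 0, 1⟩, ⟨1, 0, 1⟩, ⟨0, -φ, -φ⟩, ⟨0, 0, -φ⟩))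
              (.leaf (⟨-1, 0, 1⟩, ⟨1, 0, 1⟩, ⟨0, -φ, φ⟩, ⟨0, -φ, -φ⟩)))
            (.leaf (⟨-1, 0, 1⟩, ⟨1, 0, 1⟩, ⟨0, -φ, φ⟩, ⟨0, 0, φ⟩)))
          (.node ⟨⟨0, -1, ⟨1, 1⟩⟩, ⟨-1, -1⟩⟩
            (.leaf (⟨-1, 0, 1⟩, ⟨1, 0, 1⟩, ⟨0, φ, φ⟩, ⟨0, 0, φ⟩))
            (.node ⟨⟨0, φ, 1⟩, -1⟩
              (.leaf (⟨-1, 0, 1⟩, ⟨1, 0, 1⟩, ⟨0, φ, φ⟩, ⟨0, φ, -φ⟩))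
              (.leaf (⟨-1, 0, 1⟩, ⟨1, 0, 1⟩, ⟨0, φ, -φ⟩, ⟨0, 0, -φ⟩))))))
      (.leaf (⟨0, -φ, -φ⟩, ⟨0, φ, -φ⟩, ⟨-1, 0, 1⟩, ⟨-1, 0, -1⟩)))
  | some .T₂ =>
    (.node ⟨⟨⟨1, 1⟩, 0, -1⟩, φ⟩
      (.leaf (⟨-ψ, 0, 0⟩, ⟨0, 1, φ⟩, ⟨0, -1, φ⟩, ⟨⟨1, 1⟩, 0, 0⟩))
      (.leaf (⟨-ψ, 0, 0⟩, ⟨0, 1, φ⟩, ⟨0, -1, φ⟩, ⟨⟨-1, -1⟩, 0, 0⟩)))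
  | some .T₃ =>
    (.node ⟨⟨0, 1, ⟨1, 1⟩⟩, 0⟩
      (.node ⟨⟨0, -1, ⟨1, 1⟩⟩, 0⟩
        (.leaf (⟨0, 0, 0⟩, ⟨⟨0, 2⟩, 0, 0⟩, ⟨φ, ⟨1, 1⟩, 1⟩, ⟨⟨1, 1⟩, 1, φ⟩))
        (.leaf (⟨0, 0, 0⟩, ⟨⟨0, 2⟩, 0, 0⟩, ⟨φ, ⟨1, 1⟩, -1⟩, ⟨φ, ⟨1, 1⟩, 1⟩)))
      (.leaf (⟨0, 0, 0⟩, ⟨⟨0, 2⟩, 0, 0⟩, ⟨φ, ⟨1, 1⟩, -1⟩, ⟨⟨1, 1⟩, 1, -φ⟩)))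
  | some .T₄ =>
    (.node ⟨⟨0, 1, ⟨1, 1⟩⟩, 0⟩
      (.node ⟨⟨0, -1, ⟨1, 1⟩⟩, 0⟩
        (.leaf (⟨0, 0, 0⟩, ⟨⟨0, 2⟩, 0, 0⟩, ⟨φ, ⟨1, 1⟩, 1⟩, ⟨φ, ψ, 1⟩))
        (.leaf (⟨0, 0, 0⟩, ⟨⟨0, 2⟩, 0, 0⟩, ⟨φ, ⟨1, 1⟩, -1⟩, ⟨φ, ⟨1, 1⟩, 1⟩)))
      (.leaf (⟨0, 0, 0⟩, ⟨⟨0, 2⟩, 0, 0⟩, ⟨φ, ⟨1, 1⟩, -1⟩, ⟨⟨1, 1⟩, 1, -φ⟩)))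
  | none =>
    (.node ⟨⟨1, 0, 0⟩, -φ⟩
      (.node ⟨⟨-1, 1, -1⟩, φ⟩
        (.leaf (⟨⟨1, 1⟩, 0, -1⟩, ⟨φ, -φ, -φ⟩, ⟨φ, φ, -φ⟩, ⟨φ, φ, φ⟩))
        (.node ⟨⟨⟨1, 1⟩, 0, 1⟩, ⟨-1, -3⟩⟩
          (.leaf (⟨⟨1, 1⟩, 0, -1⟩, ⟨⟨1, 1⟩, 0, 1⟩, ⟨φ, φ, φ⟩, ⟨φ, -φ, φ⟩))
          (.leaf (⟨⟨1, 1⟩, 0, -1⟩, ⟨φ, -φ, -φ⟩, ⟨φ, φ, φ⟩, ⟨φ, -φ, φ⟩))))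
      (.node ⟨⟨0, -1, 0⟩, φ⟩
        (.node ⟨⟨0, 0, -1⟩, -φ⟩
          (.node ⟨⟨-1, 1, -1⟩, -φ⟩
            (.node ⟨⟨0, -1, ⟨1, 1⟩⟩, ⟨1, 3⟩⟩
              (.leaf (⟨0, -1, ⟨-1, -1⟩⟩, ⟨-φ, -φ, -φ⟩, ⟨φ, φ, -φ⟩, ⟨-φ, φ, -φ⟩))
              (.leaf (⟨0, -1, ⟨-1, -1⟩⟩, ⟨0, 1, ⟨-1, -1⟩⟩, ⟨φ, φ, -φ⟩, ⟨-φ, φ, -φ⟩)))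
            (.leaf (⟨0, -1, ⟨-1, -1⟩⟩, ⟨-φ, -φ, -φ⟩, ⟨φ, -φ, -φ⟩, ⟨φ, φ, -φ⟩)))
          (.node ⟨⟨0, 0, 1⟩, -φ⟩
            (.node ⟨⟨1, -1, -1⟩, φ⟩
              (.leaf (⟨0, -1, ⟨1, 1⟩⟩, ⟨-φ, -φ, φ⟩, ⟨φ, -φ, φ⟩, ⟨φ, φ, φ⟩))
              (.node ⟨⟨0, 1, ⟨1, 1⟩⟩, ⟨-1, -3⟩⟩
                (.leaf (⟨0, -1, ⟨1, 1⟩⟩, ⟨0, 1, ⟨1, 1⟩⟩, ⟨φ, φ, φ⟩, ⟨-φ, φ, φ⟩))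
                (.leaf (⟨0, -1, ⟨1, 1⟩⟩, ⟨-φ, -φ, φ⟩, ⟨φ, φ, φ⟩, ⟨-φ, φ, φ⟩))))
            (.node ⟨⟨0, 1, 0⟩, φ⟩
              (.node ⟨⟨-1, 0, 0⟩, -φ⟩
                (.node ⟨⟨-1, -1, 1⟩, -φ⟩
                  (.node ⟨⟨⟨1, 1⟩, 0, -1⟩, ⟨1, 3⟩⟩
                    (.leaf (⟨⟨-1, -1⟩, 0, -1⟩, ⟨-φ, -φ, -φ⟩, ⟨-φ, φ, φ⟩, ⟨-φ, -φ, φ⟩))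
                    (.leaf (⟨⟨-1, -1⟩, 0, -1⟩, ⟨⟨-1, -1⟩, 0, 1⟩, ⟨-φ, φ, φ⟩, ⟨-φ, -φ, φ⟩)))
                  (.leaf (⟨⟨-1, -1⟩, 0, -1⟩, ⟨-φ, -φ, -φ⟩, ⟨-φ, φ, -φ⟩, ⟨-φ, φ, φ⟩)))
                (.node ⟨⟨1, 1, -1⟩, -φ⟩
                  (.leaf (⟨φ, φ, -φ⟩, ⟨φ, φ, φ⟩, ⟨φ, -φ, -φ⟩, ⟨-φ, φ, -φ⟩))
                  (.node ⟨⟨-1, 1, -1⟩, φ⟩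
                    (.node ⟨⟨-1, 1, 1⟩, -φ⟩
                      (.leaf (⟨-φ, φ, φ⟩, ⟨φ, φ, φ⟩, ⟨-φ, φ, -φ⟩, ⟨-φ, -φ, φ⟩))
                      (.node ⟨⟨1, 1, 1⟩, φ⟩
                        (.leaf (⟨φ, φ, φ⟩, ⟨φ, -φ, -φ⟩, ⟨-φ, φ, -φ⟩, ⟨-φ, -φ, φ⟩))
                        (.leaf (⟨-φ, -φ, -φ⟩, ⟨φ, -φ, -φ⟩, ⟨-φ, φ, -φ⟩, ⟨-φ, -φ, φ⟩))))
                    (.leaf (⟨φ, -φ, φ⟩, ⟨φ, φ, φ⟩, ⟨φ, -φ, -φ⟩, ⟨-φ, -φ, φ⟩)))))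
              (.node ⟨⟨1, -1, -1⟩, -φ⟩
                (.node ⟨⟨-1, ⟨1, 1⟩, 0⟩, ⟨1, 3⟩⟩
                  (.leaf (⟨-1, ⟨-1, -1⟩, 0⟩, ⟨-φ, -φ, -φ⟩, ⟨φ, -φ, φ⟩, ⟨φ, -φ, -φ⟩))
                  (.leaf (⟨-1, ⟨-1, -1⟩, 0⟩, ⟨1, ⟨-1, -1⟩, 0⟩, ⟨φ, -φ, φ⟩, ⟨φ, -φ, -φ⟩)))
                (.leaf (⟨-1, ⟨-1, -1⟩, 0⟩, ⟨-φ, -φ, -φ⟩, ⟨-φ, -φ, φ⟩, ⟨φ, -φ, φ⟩))))))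
        (.node ⟨⟨-1, -1, 1⟩, φ⟩
          (.leaf (⟨-1, ⟨1, 1⟩, 0⟩, ⟨-φ, φ, -φ⟩, ⟨-φ, φ, φ⟩, ⟨φ, φ, φ⟩))
          (.node ⟨⟨1, ⟨1, 1⟩, 0⟩, ⟨-1, -3⟩⟩
            (.leaf (⟨-1, ⟨1, 1⟩, 0⟩, ⟨1, ⟨1, 1⟩, 0⟩, ⟨φ, φ, φ⟩, ⟨φ, φ, -φ⟩))
            (.leaf (⟨-1, ⟨1, 1⟩, 0⟩, ⟨-φ, φ, -φ⟩, ⟨φ, φ, φ⟩, ⟨φ, φ, -φ⟩))))))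

/-- The tetrahedra of which the tiles are composed. -/
def tets : Tile → List (GVec × GVec × GVec × GVec)
  | .T₁ => [
      (⟨-1, 0, 1⟩, ⟨1, 0, 1⟩, ⟨0, -φ, φ⟩, ⟨0, φ, φ⟩),
      (⟨-1, 0, 1⟩, ⟨1, 0, 1⟩, ⟨0, -φ, φ⟩, ⟨0, -φ, -φ⟩),
      (⟨-1, 0, 1⟩, ⟨1, 0, 1⟩, ⟨0, φ, φ⟩, ⟨0, φ, -φ⟩),
      (⟨-1, 0, 1⟩, ⟨1, 0, 1⟩, ⟨0, -φ, -φ⟩, ⟨0, φ, -φ⟩),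
      (⟨0, -φ, -φ⟩, ⟨0, φ, -φ⟩, ⟨-1, 0, 1⟩, ⟨-1, 0, -1⟩),
      (⟨0, -φ, -φ⟩, ⟨0, φ, -φ⟩, ⟨1, 0, 1⟩, ⟨1, 0, -1⟩)]
  | .T₂ => [
      (⟨-ψ, 0, 0⟩, ⟨0, 1, φ⟩, ⟨0, -1, φ⟩, ⟨⟨-1, -1⟩, 0, 0⟩),
      (⟨-ψ, 0, 0⟩, ⟨0, 1, φ⟩, ⟨0, -1, φ⟩, ⟨⟨1, 1⟩, 0, 0⟩)]
  | .T₃ => [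
      (⟨0, 0, 0⟩, ⟨⟨0, 2⟩, 0, 0⟩, ⟨φ, ⟨1, 1⟩, -1⟩, ⟨φ, ⟨1, 1⟩, 1⟩),
      (⟨0, 0, 0⟩, ⟨⟨0, 2⟩, 0, 0⟩, ⟨φ, ⟨1, 1⟩, -1⟩, ⟨⟨1, 1⟩, 1, -φ⟩),
      (⟨0, 0, 0⟩, ⟨⟨0, 2⟩, 0, 0⟩, ⟨φ, ⟨1, 1⟩, 1⟩, ⟨⟨1, 1⟩, 1, φ⟩)]
  | .T₄ => [
      (⟨0, 0, 0⟩, ⟨⟨0, 2⟩, 0, 0⟩, ⟨φ, ⟨1, 1⟩, -1⟩, ⟨φ, ⟨1, 1⟩, 1⟩),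
      (⟨0, 0, 0⟩, ⟨⟨0, 2⟩, 0, 0⟩, ⟨φ, ⟨1, 1⟩, -1⟩, ⟨⟨1, 1⟩, 1, -φ⟩),
      (⟨0, 0, 0⟩, ⟨⟨0, 2⟩, 0, 0⟩, ⟨φ, ⟨1, 1⟩, 1⟩, ⟨φ, ψ, 1⟩)]

/-- The four vertices of a tetrahedron. -/
def quad (q : GVec × GVec × GVec × GVec) : List GVec := [q.1, q.2.1, q.2.2.1, q.2.2.2]

theorem gtet_eq_ghull (q : GVec × GVec × GVec × GVec) : gtet q = ghull (1 / 2) (quad q) := by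
  unfold gtet tet ghull
  congr 1
  ext x
  simp [quad, eq_comm]

theorem ghull_mono {u : ℝ} {V W : List GVec} (h : ∀ p ∈ V, p ∈ W) : ghull u V ⊆ ghull u W :=
  convexHull_mono (Set.image_mono h)

/-- Every point in `V` is the midpoint of two points in `W`. -/
def midCheck (V W : List GVec) : Bool :=
  V.all fun p => W.any fun a => W.any fun b => decide (p + p = a + b)

theorem ghull_subset_of_midCheck {u : ℝ} {V W : List GVec} (h : midCheck V W = true) :
    ghull u V ⊆ ghull u W := by
  refine convexHull_min ?_ (convex_ghull u W)
  rintro _ ⟨p, hp, rfl⟩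
  simp only [midCheck, List.all_eq_true, List.any_eq_true, decide_eq_true_eq] at h
  obtain ⟨a, ha, b, hb, hab⟩ := h p hp
  have hadd : ∀ p q : GVec, (p + q).toSpace = p.toSpace + q.toSpace := fun p q => by
    ext i
    fin_cases i
    exacts [val_add p.x q.x, val_add p.y q.y, val_add p.z q.z]
  have h2 : p.toSpace + p.toSpace = a.toSpace + b.toSpace := by rw [← hadd, ← hadd, hab]
  have h3 : u • p.toSpace = (1 / 2 : ℝ) • (u • a.toSpace) + (1 / 2 : ℝ) • (u • b.toSpace) := by
    rw [← smul_add, ← smul_add, ← h2, ← two_smul ℝ p.toSpace, smul_smul, smul_smul]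
    congr 1; ring
  change u • p.toSpace ∈ _
  rw [h3]
  exact convex_ghull u W (subset_convexHull ℝ _ ⟨a, ha, rfl⟩) (subset_convexHull ℝ _ ⟨b, hb, rfl⟩)
    (by norm_num) (by norm_num) (by norm_num)

/-- The vertices, facets and partition of a solid fit together. -/
def bodyCheck (s : Option Tile) : Bool :=
  (partition s).check (faces s) &&
  ((partition s).cells.all fun q => (quad q).all fun p => decide (p ∈ verts s)) &&
  ((faces s).all fun g => (verts s).all fun p => (g.eval p).isNonneg)

theorem bodyCheck_eq_true (s : Option Tile) : bodyCheck s = true := by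
  rcases s with _ | _ | _ | _ | _ <;> decide +kernel

/-- The tetrahedra of which a tile is composed fill the same solid as the cells of its partition. -/
def tetsCheck (t : Tile) : Bool :=
  ((tets t).all fun q => (quad q).all fun p => decide (p ∈ verts (some t))) &&
  ((partition (some t)).cells.all fun q => (tets t).any fun q' => midCheck (quad q) (quad q'))

theorem tetsCheck_eq_true (t : Tile) : tetsCheck t = true := by
  rcases t with _ | _ | _ | _ <;> decide +kernel

theorem partition_check (s : Option Tile) : (partition s).check (faces s) = true := by
  have h := bodyCheck_eq_true s
  simp only [bodyCheck, Bool.and_eq_true] at h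
  exact h.1.1

/-- The listed points satisfy all facet inequalities; conversely the facets cut out the union of the
cells, whose vertices are all listed. The points beyond the true vertices are listed for the sake of
the cells. -/
theorem ghull_verts (s : Option Tile) : ghull (1 / 2) (verts s) = gpoly (1 / 2) (faces s) := by
  have h := bodyCheck_eq_true s
  simp only [bodyCheck, Bool.and_eq_true, List.all_eq_true, decide_eq_true_eq] at h
  refine Set.Subset.antisymm (fun x hx g hg => ?_) ?_
  · exact ghull_subset_halfspace (by norm_num) (h.2 g hg) hx
  · rw [BSP.gpoly_eq_cells h.1.1]
    rintro x ⟨q, hq, hx⟩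
    rw [gtet_eq_ghull] at hx
    exact ghull_mono (h.1.2 q hq) hx

/-- The union of a list of tetrahedra. -/
noncomputable def tetUnion : List (GVec × GVec × GVec × GVec) → Set Space
  | [] => ∅
  | q :: L => gtet q ∪ tetUnion L

theorem mem_tetUnion {L : List (GVec × GVec × GVec × GVec)} {x : Space} :
    x ∈ tetUnion L ↔ ∃ q ∈ L, x ∈ gtet q := by
  induction L with
  | nil => simp [tetUnion]
  | cons q L ih => simp [tetUnion, ih]

theorem solid_eq_tetUnion (t : Tile) : t.solid = tetUnion (tets t) := by
  have h2 := Real.goldenRatio_sq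
  have hv : ∀ a b : ℤ, GInt.val ⟨a, b⟩ = a + b * τ := fun _ _ => rfl
  cases t <;>
    simp only [Tile.solid, solidT₁, solidT₂, solidT₃, solidT₄, tets, tetUnion,
      Set.union_empty, ← Set.union_assoc, gtet, GVec.half_smul_toSpace] <;>
    -- What remains are equalities of coordinates, at most using τ² = τ + 1.
    congr! 9 <;> first | (simp [val_zero, val_one]; done) | (simp [hv] <;> linarith)

/-- The solid with a given label, not inflated. -/
noncomputable def baseSolid : Option Tile → Set Space
  | none => convexHull ℝ dodVertices
  | some t => t.solid

theorem dodVertices_eq :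
    dodVertices = (fun p : GVec => (1 / 2 : ℝ) • p.toSpace) '' {p | p ∈ verts none} := by
  have h2 := Real.goldenRatio_sq
  have hv : ∀ a b : ℤ, GInt.val ⟨a, b⟩ = a + b * τ := fun _ _ => rfl
  have e1 : (⟨1, 1⟩ : GInt).val = τ ^ 2 := by rw [hv, h2]; push_cast; ring
  have e2 : (⟨-1, -1⟩ : GInt).val = -τ ^ 2 := by rw [hv, h2]; push_cast; ring
  ext x
  simp only [dodVertices, Set.mem_insert_iff, Set.mem_singleton_iff, exists_eq_or_imp,
    exists_eq_left, verts, Set.mem_image, Set.mem_ofPred_eq, List.mem_cons, List.not_mem_nil,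
    or_false, GVec.half_smul_toSpace, val_neg, val_φ, val_zero, val_one, e1, e2, one_mul, neg_mul]
  simp only [@eq_comm _ x]
  tauto

/-- A tile is defined as a union of tetrahedra, and here it turns out to be convex. Mutual inclusion
suffices: the defining tetrahedra have vertices in the hull, and each cell lies in one of them.
Midpoints enter because the partition of T₁ halves its t₁ and t₆ along the plane y = 0. -/
theorem baseSolid_eq (s : Option Tile) : baseSolid s = gpoly (1 / 2) (faces s) := by
  cases s with
  | none => rw [← ghull_verts, baseSolid, dodVertices_eq, ghull]
  | some t =>
    have h := tetsCheck_eq_true t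
    simp only [tetsCheck, Bool.and_eq_true, List.all_eq_true, List.any_eq_true,
      decide_eq_true_eq] at h
    change t.solid = _
    ext x
    rw [solid_eq_tetUnion, mem_tetUnion]
    constructor
    · rintro ⟨q, hq, hx⟩
      rw [gtet_eq_ghull] at hx
      rw [← ghull_verts]
      exact ghull_mono (h.1 q hq) hx
    · rw [BSP.gpoly_eq_cells (partition_check (some t))]
      rintro ⟨q, hq, hx⟩
      obtain ⟨q', hq', hm⟩ := h.2 q hq
      rw [gtet_eq_ghull] at hx
      refine ⟨q', hq', ?_⟩
      rw [gtet_eq_ghull]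
      exact ghull_subset_of_midCheck hm hx

/-! ### Inflated solids. -/

/-- A composite tile or the dodecahedron (for `none`), with an order of inflation. -/
abbrev Label : Type := Option Tile × ℕ

namespace Label

/-- The inflated solid with a given label. -/
noncomputable def solid : Label → Set Space
  | (none, n) => dod n
  | (some t, n) => t.infl n

theorem solid_eq_smul (s : Option Tile) (n : ℕ) : solid (s, n) = τ ^ n • baseSolid s := by
  cases s <;> rfl

/-- The vertices of an inflated solid. -/
def verts (l : Label) : List GVec := (_root_.verts l.1).map (GVec.scale (φpow l.2))

/-- The facet planes of an inflated solid, in units of a quarter of the short edge. -/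
def faces (l : Label) : List GPlane :=
  (_root_.faces l.1).map fun g => ⟨g.normal, 2 * (φpow l.2 * g.const)⟩

/-- Six times the volume, in suitable units. -/
def vol (l : Label) : GInt := φpow (3 * l.2) * (partition l.1).vol

theorem solid_eq_ghull (l : Label) : l.solid = ghull (1 / 2) l.verts := by
  obtain ⟨s, n⟩ := l
  rw [solid_eq_smul, baseSolid_eq, ← ghull_verts, ghull, ghull, ← convexHull_smul]
  congr 1
  ext x
  simp only [verts, Set.mem_smul_set, Set.mem_image, Set.mem_ofPred_eq, List.mem_map]
  constructor
  · rintro ⟨_, ⟨p, hp, rfl⟩, rfl⟩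
    refine ⟨_, ⟨p, hp, rfl⟩, ?_⟩
    rw [GVec.toSpace_scale, val_φpow, smul_comm]
  · rintro ⟨_, ⟨p, hp, rfl⟩, rfl⟩
    refine ⟨_, ⟨p, hp, rfl⟩, ?_⟩
    rw [GVec.toSpace_scale, val_φpow, smul_comm]

theorem pow_pos (n : ℕ) : 0 < τ ^ n := _root_.pow_pos Real.goldenRatio_pos n

/-- Dilation changes only the constants of the facet planes. The factor 2 in `faces` compensates for
passing from units of 1/2 to units of 1/4, where moved pieces have their coordinates. -/
theorem solid_eq_gpoly (l : Label) : l.solid = gpoly (1 / 4) l.faces := by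
  obtain ⟨s, n⟩ := l
  have hτ := pow_pos n
  rw [solid_eq_smul, baseSolid_eq]
  ext x
  rw [Set.mem_smul_set_iff_inv_smul_mem₀ hτ.ne']
  simp only [gpoly, faces, Set.mem_ofPred_eq, List.mem_map, forall_exists_index, and_imp,
    forall_apply_eq_imp_iff₂]
  refine forall₂_congr fun g _ => ?_
  rw [← mul_nonneg_iff_of_pos_left hτ]
  have : τ ^ n * g.aff (1 / 2) ((τ ^ n)⁻¹ • x) =
      GPlane.aff ⟨g.normal, 2 * (φpow n * g.const)⟩ (1 / 4) x := by
    simp only [GPlane.aff_apply, val_mul, val_two, val_φpow, PiLp.smul_apply, smul_eq_mul]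
    field_simp
    ring
  rw [this]

theorem isClosed_solid (l : Label) : IsClosed l.solid := by
  rw [solid_eq_gpoly]
  exact isClosed_gpoly _ _

theorem convex_solid (l : Label) : Convex ℝ l.solid := by
  rw [solid_eq_gpoly]
  exact convex_gpoly _ _

theorem volume_solid_lt_top (l : Label) : volume l.solid < ⊤ := by
  rw [solid_eq_ghull]
  exact (isCompact_ghull _ _).measure_lt_top

theorem interior_solid_nonempty (l : Label) : (interior l.solid).Nonempty := by
  obtain ⟨s, n⟩ := l
  rw [solid_eq_smul, baseSolid_eq, interior_smul₀ (pow_pos n).ne']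
  exact (BSP.interior_gpoly_nonempty (partition_check s)).smul_set

theorem val_vol_nonneg (l : Label) : 0 ≤ l.vol.val := by
  rw [vol, val_mul, val_φpow]
  exact mul_nonneg (pow_pos _).le (BSP.val_vol_nonneg (partition_check l.1))

theorem volume_solid (l : Label) : volume l.solid = ENNReal.ofReal l.vol.val * tetUnit := by
  obtain ⟨s, n⟩ := l
  rw [solid_eq_smul, baseSolid_eq, Measure.addHaar_smul,
    BSP.volume_gpoly (partition_check s), ← mul_assoc, ← ENNReal.ofReal_mul (abs_nonneg _)]
  congr 2
  rw [vol, val_mul, val_φpow, finrank_euclideanSpace_fin, ← pow_mul, mul_comm n 3,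
    abs_of_pos (pow_pos _)]

end Label

/-! ### Certificates for dissections. -/

/-- The solids with the given vertices lie on different sides of one of the planes. -/
def separated (planes : List GPlane) (V W : List GVec) : Bool :=
  planes.any fun g =>
    (V.all fun p => (g.eval p).isNonneg) && (W.all fun p => (g.flip.eval p).isNonneg) ||
    (W.all fun p => (g.eval p).isNonneg) && (V.all fun p => (g.flip.eval p).isNonneg)

/-- Every two of the solids with the given vertices are separated by one of the planes. -/
def allSeparated (planes : List GPlane) : List (List GVec) → Bool
  | [] => true
  | V :: Vs => Vs.all (separated planes V) && allSeparated planes Vs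

theorem pairwise_of_allSeparated {planes : List GPlane} {Vs : List (List GVec)}
    (h : allSeparated planes Vs = true) : Vs.Pairwise fun V W => separated planes V W = true := by
  induction Vs with
  | nil => exact List.Pairwise.nil
  | cons V Vs ih =>
    simp only [allSeparated, Bool.and_eq_true, List.all_eq_true] at h
    exact List.Pairwise.cons h.1 (ih h.2)

theorem disjoint_of_separated {u : ℝ} (hu : 0 ≤ u) {planes : List GPlane}
    (hp : ∀ g ∈ planes, (g.normal.dot g.normal).isPos = true) {V W : List GVec}
    (h : separated planes V W = true) : Disjoint (interior (ghull u V)) (interior (ghull u W)) := by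
  simp only [separated, List.any_eq_true, Bool.or_eq_true, Bool.and_eq_true,
    List.all_eq_true] at h
  obtain ⟨g, hg, h | h⟩ := h
  · exact disjoint_interior_of_separated (hp g hg) (ghull_subset_halfspace hu h.1)
      (ghull_subset_halfspace hu h.2)
  · exact (disjoint_interior_of_separated (hp g hg) (ghull_subset_halfspace hu h.1)
      (ghull_subset_halfspace hu h.2)).symm

/-- The vertices of the pieces of a dissection, in units of a quarter of the short edge. -/
def pieceVerts (p : Label × Motion) : List GVec := p.1.verts.map p.2.app

/-- A list of moved solids is a dissection of the solid with a given label. -/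
def dissectionCheck (l : Label) (pieces : List (Label × Motion)) (planes : List GPlane) : Bool :=
  (pieces.all fun p => p.2.check) &&
  (planes.all fun g => (g.normal.dot g.normal).isPos) &&
  (pieces.all fun p => l.faces.all fun g => (pieceVerts p).all fun v => (g.eval v).isNonneg) &&
  allSeparated planes (pieces.map pieceVerts) &&
  decide (l.vol = (pieces.map fun p : Label × Motion => p.1.vol).foldr (· + ·) 0)

/-- The solid with label `l` can be dissected into the solids with labels in `m`. -/
def DissectsInto (l : Label) (m : Multiset Label) : Prop := Dissects l.solid (m.map Label.solid)

/-- Solids with pairwise disjoint interiors in a convex body that has the same volume fill it. -/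
theorem eq_iUnion_of_volume {n : ℕ} {A : Set Space} {P : Fin n → Set Space} (hA : Convex ℝ A)
    (hc : IsClosed A) (hi : (interior A).Nonempty) (hv : volume A < ⊤) (hP : ∀ k, IsClosed (P k))
    (hPc : ∀ k, Convex ℝ (P k)) (hPA : ∀ k, P k ⊆ A)
    (hd : Pairwise fun k l => Disjoint (interior (P k)) (interior (P l)))
    (hV : volume A = ∑ k, volume (P k)) : A = ⋃ k, P k := by
  refine Set.Subset.antisymm ?_ (Set.iUnion_subset hPA)
  have hU : IsClosed (⋃ k, P k) := isClosed_iUnion_of_finite hP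
  have hvU : volume (⋃ k, P k) = volume A := by
    rw [measure_iUnion₀ (fun k l hkl => aedisjoint_of_convex (hPc k) (hPc l) (hd hkl))
      (fun k => (hP k).measurableSet.nullMeasurableSet), tsum_fintype, hV]
  have h0 : volume (A \ ⋃ k, P k) = 0 := by
    rw [measure_sdiff (Set.iUnion_subset hPA) hU.measurableSet.nullMeasurableSet
      (hvU ▸ hv.ne), hvU, tsub_self]
  -- An uncovered interior point would have an open uncovered neighbourhood, of positive volume.
  have hint : interior A ⊆ ⋃ k, P k := by
    by_contra hne
    obtain ⟨x, hx, hxU⟩ := Set.not_subset.mp hne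
    have hpos := (isOpen_interior.sdiff hU).measure_pos volume ⟨x, hx, hxU⟩
    exact hpos.ne' (measure_mono_null (Set.sdiff_subset_sdiff_left interior_subset) h0)
  calc A = closure A := hc.closure_eq.symm
    _ = closure (interior A) := (hA.closure_interior_eq_closure_of_nonempty_interior hi).symm
    _ ⊆ ⋃ k, P k := closure_minimal hint hU

/-- Containment, separation and equality of volumes are exactly the hypotheses of
`eq_iUnion_of_volume`; motions preserve volume, so the volumes of the unmoved solids can be summed.
-/
theorem dissectsInto_of_check {l : Label} {pieces : List (Label × Motion)}
    {planes : List GPlane} (h : dissectionCheck l pieces planes = true) :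
    DissectsInto l (pieces.map Prod.fst : List Label) := by
  simp only [dissectionCheck, Bool.and_eq_true, List.all_eq_true, decide_eq_true_eq] at h
  obtain ⟨⟨⟨⟨hm, hpl⟩, hin⟩, hsep⟩, hvol⟩ := h
  have hm' : ∀ k : Fin pieces.length, (pieces.get k).2.check = true :=
    fun k => hm _ (List.get_mem _ _)
  let P : Fin pieces.length → Set Space :=
    fun k => Motion.equiv (hm' k) '' (pieces.get k).1.solid
  have hP : ∀ k, P k = ghull (1 / 4) (pieceVerts (pieces.get k)) := fun k => by
    simp only [P, Label.solid_eq_ghull, Motion.image_ghull, pieceVerts]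
  have hd : Pairwise fun k l => Disjoint (interior (P k)) (interior (P l)) := by
    have h1 := pairwise_of_allSeparated hsep
    rw [List.pairwise_map, List.pairwise_iff_get] at h1
    intro i j hij
    simp only [hP]
    rcases lt_or_gt_of_ne hij with h | h
    · exact disjoint_of_separated (by norm_num) hpl (h1 i j h)
    · exact (disjoint_of_separated (by norm_num) hpl (h1 j i h)).symm
  refine ⟨pieces.length, fun k => (pieces.get k).1.solid, P, ?_, fun k => ⟨_, rfl⟩, ?_, hd⟩
  · rw [Multiset.map_coe, List.map_map]
    congr 1
    conv_rhs => rw [← List.ofFn_get pieces, List.map_ofFn]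
    rfl
  · refine eq_iUnion_of_volume l.convex_solid l.isClosed_solid l.interior_solid_nonempty
      l.volume_solid_lt_top (fun k => ?_) (fun k => ?_) (fun k => ?_) hd ?_
    · rw [hP]; exact (isCompact_ghull _ _).isClosed
    · rw [hP]; exact convex_ghull _ _
    · rw [hP, Label.solid_eq_gpoly]
      exact fun x hx g hg =>
        ghull_subset_halfspace (by norm_num) (hin _ (List.get_mem _ _) g hg) hx
    · have h1 : ∀ L : List (Label × Motion),
          0 ≤ ((L.map fun p : Label × Motion => p.1.vol).foldr (· + ·) 0).val ∧
          ENNReal.ofReal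
              ((L.map fun p : Label × Motion => p.1.vol).foldr (· + ·) 0).val * tetUnit =
            (L.map fun p : Label × Motion => volume p.1.solid).sum := by
        intro L
        induction L with
        | nil => simp [val_zero]
        | cons p L ih =>
          simp only [List.map_cons, List.foldr_cons, List.sum_cons, val_add]
          refine ⟨add_nonneg p.1.val_vol_nonneg ih.1, ?_⟩
          rw [ENNReal.ofReal_add p.1.val_vol_nonneg ih.1, add_mul, ih.2, Label.volume_solid]
      rw [Label.volume_solid, hvol, (h1 pieces).2]
      simp only [P, Motion.volume_image _ (Label.isClosed_solid _)]
      rw [← List.sum_ofFn]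
      congr 1
      conv_lhs => rw [← List.ofFn_get pieces, List.map_ofFn]
      rfl

/-! ### The eight basic dissections. -/

/-- In this and the following certificates the separating planes need only six normal directions,
those of the faces of the dodecahedron. -/
def piecesT₁One : List (Label × Motion) := [
    ((some .T₁, 0), ⟨⟨0, 0, -2⟩, ⟨-2, 0, 0⟩, ⟨0, -2, 0⟩, ⟨0, 0, 0⟩⟩),
    ((some .T₂, 0), ⟨⟨ψ, -1, -φ⟩, ⟨-1, -φ, ψ⟩, ⟨φ, -ψ, 1⟩, ⟨φ, ⟨1, 1⟩, -1⟩⟩),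
    ((some .T₂, 0), ⟨⟨ψ, -1, -φ⟩, ⟨1, φ, -ψ⟩, ⟨-φ, ψ, -1⟩, ⟨φ, ⟨-1, -1⟩, 1⟩⟩),
    ((some .T₃, 0), ⟨⟨-1, φ, ψ⟩, ⟨-φ, -ψ, -1⟩, ⟨ψ, 1, -φ⟩, ⟨0, ⟨2, 2⟩, ⟨-2, -2⟩⟩⟩),
    ((some .T₃, 0), ⟨⟨-1, φ, ψ⟩, ⟨φ, ψ, 1⟩, ⟨-ψ, -1, φ⟩, ⟨0, ⟨-2, -2⟩, ⟨2, 2⟩⟩⟩),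
    ((some .T₄, 0), ⟨⟨-2, 0, 0⟩, ⟨0, 2, 0⟩, ⟨0, 0, 2⟩, ⟨⟨0, 2⟩, 0, ⟨0, 2⟩⟩⟩),
    ((some .T₄, 0), ⟨⟨-2, 0, 0⟩, ⟨0, -2, 0⟩, ⟨0, 0, -2⟩, ⟨⟨0, 2⟩, 0, ⟨0, -2⟩⟩⟩)]

theorem dissectionCheck_T₁One : dissectionCheck (some .T₁, 1) piecesT₁One [
    ⟨⟨0, φ, 1⟩, ⟨0, -2⟩⟩, ⟨⟨0, φ, 1⟩, ⟨0, 2⟩⟩, ⟨⟨0, φ, -1⟩, ⟨0, -2⟩⟩, ⟨⟨0, φ, -1⟩, ⟨0, 2⟩⟩,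
    ⟨⟨1, 0, φ⟩, 2⟩, ⟨⟨1, 0, -φ⟩, 2⟩] = true := by
  decide +kernel

def piecesT₂One : List (Label × Motion) := [
    ((some .T₂, 0), ⟨⟨-φ, ψ, 1⟩, ⟨ψ, -1, φ⟩, ⟨-1, -φ, -ψ⟩, ⟨⟨-1, -2⟩, -φ, ⟨1, 1⟩⟩⟩),
    ((some .T₂, 0), ⟨⟨-φ, ψ, -1⟩, ⟨-ψ, 1, φ⟩, ⟨1, φ, -ψ⟩, ⟨⟨1, 2⟩, -φ, ⟨1, 1⟩⟩⟩),
    ((some .T₃, 0), ⟨⟨-1, φ, ψ⟩, ⟨φ, ψ, 1⟩, ⟨-ψ, -1, φ⟩, ⟨0, ⟨0, -2⟩, ⟨2, 2⟩⟩⟩)]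

theorem dissectionCheck_T₂One : dissectionCheck (some .T₂, 1) piecesT₂One [
    ⟨⟨φ, 1, 0⟩, ⟨0, 2⟩⟩, ⟨⟨φ, -1, 0⟩, ⟨0, -2⟩⟩] = true := by
  decide +kernel

def piecesT₃One : List (Label × Motion) := [
    ((some .T₁, 0), ⟨⟨-2, 0, 0⟩, ⟨0, -2, 0⟩, ⟨0, 0, -2⟩, ⟨⟨2, 2⟩, ⟨2, 2⟩, 0⟩⟩),
    ((some .T₂, 0), ⟨⟨-1, -φ, -ψ⟩, ⟨φ, -ψ, -1⟩, ⟨ψ, -1, φ⟩, ⟨⟨3, 3⟩, ⟨1, 2⟩, φ⟩⟩),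
    ((some .T₂, 0), ⟨⟨-1, -φ, -ψ⟩, ⟨φ, -ψ, -1⟩, ⟨-ψ, 1, -φ⟩, ⟨⟨3, 3⟩, ⟨1, 2⟩, -φ⟩⟩),
    ((some .T₃, 0), ⟨⟨φ, ψ, -1⟩, ⟨ψ, 1, φ⟩, ⟨-1, φ, -ψ⟩, ⟨0, 0, 0⟩⟩),
    ((some .T₄, 0), ⟨⟨-φ, -ψ, -1⟩, ⟨ψ, 1, -φ⟩, ⟨-1, φ, ψ⟩, ⟨⟨4, 4⟩, 0, 0⟩⟩)]

theorem dissectionCheck_T₃One : dissectionCheck (some .T₃, 1) piecesT₃One [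
    ⟨⟨1, 0, φ⟩, ⟨-4, -4⟩⟩, ⟨⟨1, 0, -φ⟩, ⟨-4, -4⟩⟩, ⟨⟨φ, 1, 0⟩, ⟨-4, -4⟩⟩, ⟨⟨φ, -1, 0⟩, ⟨0, -4⟩⟩] =
      true := by
  decide +kernel

def piecesT₄One : List (Label × Motion) := [
    ((some .T₁, 0), ⟨⟨-2, 0, 0⟩, ⟨0, -2, 0⟩, ⟨0, 0, -2⟩, ⟨⟨2, 2⟩, ⟨2, 2⟩, 0⟩⟩),
    ((some .T₂, 0), ⟨⟨-1, -φ, -ψ⟩, ⟨φ, -ψ, -1⟩, ⟨-ψ, 1, -φ⟩, ⟨⟨3, 3⟩, ⟨1, 2⟩, -φ⟩⟩),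
    ((some .T₃, 0), ⟨⟨φ, ψ, -1⟩, ⟨ψ, 1, φ⟩, ⟨-1, φ, -ψ⟩, ⟨0, 0, 0⟩⟩),
    ((some .T₄, 0), ⟨⟨-φ, -ψ, -1⟩, ⟨ψ, 1, -φ⟩, ⟨-1, φ, ψ⟩, ⟨⟨4, 4⟩, 0, 0⟩⟩)]

theorem dissectionCheck_T₄One : dissectionCheck (some .T₄, 1) piecesT₄One [
    ⟨⟨1, 0, -φ⟩, ⟨-4, -4⟩⟩, ⟨⟨φ, 1, 0⟩, ⟨-4, -4⟩⟩, ⟨⟨φ, -1, 0⟩, ⟨0, -4⟩⟩] =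
      true := by
  decide +kernel

def piecesDod : List (Label × Motion) := [
    ((some .T₁, 0), ⟨⟨-1, -φ, ψ⟩, ⟨-φ, ψ, -1⟩, ⟨ψ, -1, -φ⟩, ⟨φ, ⟨1, 1⟩, -1⟩⟩),
    ((some .T₁, 0), ⟨⟨ψ, -1, -φ⟩, ⟨-1, -φ, ψ⟩, ⟨-φ, ψ, -1⟩, ⟨-1, φ, ⟨1, 1⟩⟩⟩),
    ((some .T₁, 0), ⟨⟨-φ, ψ, -1⟩, ⟨ψ, -1, -φ⟩, ⟨-1, -φ, ψ⟩, ⟨⟨1, 1⟩, -1, φ⟩⟩),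
    ((some .T₂, 0), ⟨⟨0, -2, 0⟩, ⟨0, 0, -2⟩, ⟨-2, 0, 0⟩, ⟨0, -2, 0⟩⟩),
    ((some .T₂, 0), ⟨⟨-2, 0, 0⟩, ⟨0, -2, 0⟩, ⟨0, 0, -2⟩, ⟨0, 0, -2⟩⟩),
    ((some .T₂, 0), ⟨⟨0, 0, -2⟩, ⟨-2, 0, 0⟩, ⟨0, -2, 0⟩, ⟨-2, 0, 0⟩⟩),
    ((some .T₂, 0), ⟨⟨-1, -φ, -ψ⟩, ⟨-φ, ψ, 1⟩, ⟨-ψ, 1, -φ⟩, ⟨ψ, -1, φ⟩⟩),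
    ((some .T₄, 0), ⟨⟨φ, ψ, -1⟩, ⟨ψ, 1, φ⟩, ⟨-1, φ, -ψ⟩, ⟨⟨-2, -2⟩, 0, -2⟩⟩),
    ((some .T₄, 0), ⟨⟨ψ, 1, φ⟩, ⟨-1, φ, -ψ⟩, ⟨φ, ψ, -1⟩, ⟨0, -2, ⟨-2, -2⟩⟩⟩),
    ((some .T₄, 0), ⟨⟨-1, φ, -ψ⟩, ⟨φ, ψ, -1⟩, ⟨ψ, 1, φ⟩, ⟨-2, ⟨-2, -2⟩, 0⟩⟩),
    ((some .T₄, 0), ⟨⟨-1, φ, -ψ⟩, ⟨φ, ψ, -1⟩, ⟨-ψ, -1, -φ⟩, ⟨-2, ⟨-2, -2⟩, 0⟩⟩)]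

theorem dissectionCheck_Dod : dissectionCheck (none, 0) piecesDod [
    ⟨⟨1, 0, -φ⟩, 2⟩, ⟨⟨φ, -1, 0⟩, -2⟩, ⟨⟨0, φ, -1⟩, -2⟩, ⟨⟨1, 0, φ⟩, 2⟩, ⟨⟨φ, 1, 0⟩, 2⟩,
    ⟨⟨0, φ, 1⟩, 2⟩, ⟨⟨1, 0, φ⟩, -2⟩, ⟨⟨φ, 1, 0⟩, -2⟩, ⟨⟨0, φ, 1⟩, -2⟩] = true := by
  decide +kernel

/-- Iterating the order-one rules on a tile yields tiles only, so the dissections of order two with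
a whole dodecahedron as a piece need certificates of their own. -/
def piecesT₃Two : List (Label × Motion) := [
    ((none, 0), ⟨⟨-2, 0, 0⟩, ⟨0, -2, 0⟩, ⟨0, 0, -2⟩, ⟨⟨2, 4⟩, ⟨2, 2⟩, 0⟩⟩),
    ((some .T₂, 0), ⟨⟨ψ, -1, φ⟩, ⟨1, φ, ψ⟩, ⟨φ, -ψ, -1⟩, ⟨⟨2, 3⟩, ⟨3, 5⟩, 1⟩⟩),
    ((some .T₂, 0), ⟨⟨-φ, ψ, 1⟩, ⟨ψ, -1, φ⟩, ⟨1, φ, ψ⟩, ⟨⟨3, 4⟩, ⟨2, 3⟩, ⟨-1, -3⟩⟩⟩),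
    ((some .T₂, 0), ⟨⟨-1, -φ, -ψ⟩, ⟨φ, -ψ, -1⟩, ⟨-ψ, 1, -φ⟩, ⟨⟨3, 5⟩, ⟨3, 4⟩, ⟨2, 3⟩⟩⟩),
    ((some .T₂, 0), ⟨⟨ψ, -1, φ⟩, ⟨1, φ, ψ⟩, ⟨φ, -ψ, -1⟩, ⟨⟨4, 5⟩, ⟨1, 1⟩, ⟨1, 2⟩⟩⟩),
    ((some .T₂, 0), ⟨⟨ψ, -1, φ⟩, ⟨1, φ, ψ⟩, ⟨-φ, ψ, 1⟩, ⟨⟨4, 5⟩, ⟨1, 1⟩, ⟨-1, -2⟩⟩⟩),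
    ((some .T₃, 0), ⟨⟨φ, ψ, -1⟩, ⟨ψ, 1, φ⟩, ⟨-1, φ, -ψ⟩, ⟨0, 0, 0⟩⟩),
    ((some .T₃, 0), ⟨⟨-1, φ, ψ⟩, ⟨-φ, -ψ, -1⟩, ⟨-ψ, -1, φ⟩, ⟨⟨2, 4⟩, ⟨4, 6⟩, ⟨2, 2⟩⟩⟩),
    ((some .T₃, 0), ⟨⟨-φ, ψ, -1⟩, ⟨ψ, -1, -φ⟩, ⟨1, φ, -ψ⟩, ⟨⟨4, 6⟩, ⟨2, 2⟩, ⟨-2, -4⟩⟩⟩),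
    ((some .T₃, 0), ⟨⟨φ, ψ, -1⟩, ⟨ψ, 1, φ⟩, ⟨-1, φ, -ψ⟩, ⟨⟨2, 2⟩, ⟨2, 4⟩, ⟨0, -2⟩⟩⟩),
    ((some .T₃, 0), ⟨⟨-φ, ψ, -1⟩, ⟨ψ, -1, -φ⟩, ⟨-1, -φ, ψ⟩, ⟨⟨4, 6⟩, ⟨2, 2⟩, ⟨2, 4⟩⟩⟩),
    ((some .T₃, 0), ⟨⟨φ, ψ, -1⟩, ⟨ψ, 1, φ⟩, ⟨-1, φ, -ψ⟩, ⟨⟨4, 4⟩, 0, 0⟩⟩)]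

theorem dissectionCheck_T₃Two : dissectionCheck (some .T₃, 2) piecesT₃Two [
    ⟨⟨1, 0, -φ⟩, ⟨-4, -4⟩⟩, ⟨⟨φ, -1, 0⟩, ⟨-4, -8⟩⟩, ⟨⟨0, φ, -1⟩, ⟨-4, -8⟩⟩,
    ⟨⟨1, 0, φ⟩, ⟨-4, -8⟩⟩, ⟨⟨0, φ, 1⟩, ⟨-4, -8⟩⟩, ⟨⟨1, 0, φ⟩, ⟨-4, -4⟩⟩, ⟨⟨1, 0, -φ⟩, ⟨-4, -8⟩⟩,
    ⟨⟨φ, 1, 0⟩, ⟨-4, -4⟩⟩, ⟨⟨0, φ, 1⟩, ⟨-4, -4⟩⟩] = true := by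
  decide +kernel

def piecesT₄Two : List (Label × Motion) := [
    ((none, 0), ⟨⟨-2, 0, 0⟩, ⟨0, -2, 0⟩, ⟨0, 0, -2⟩, ⟨⟨2, 4⟩, ⟨2, 2⟩, 0⟩⟩),
    ((some .T₂, 0), ⟨⟨0, -2, 0⟩, ⟨0, 0, -2⟩, ⟨-2, 0, 0⟩, ⟨⟨2, 4⟩, ⟨4, 6⟩, 0⟩⟩),
    ((some .T₂, 0), ⟨⟨ψ, -1, -φ⟩, ⟨-1, -φ, ψ⟩, ⟨φ, -ψ, 1⟩, ⟨⟨4, 7⟩, ⟨1, 1⟩, ⟨-1, -2⟩⟩⟩),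
    ((some .T₂, 0), ⟨⟨-1, -φ, -ψ⟩, ⟨φ, -ψ, -1⟩, ⟨ψ, -1, φ⟩, ⟨⟨3, 5⟩, ⟨3, 4⟩, ⟨-2, -3⟩⟩⟩),
    ((some .T₃, 0), ⟨⟨-1, φ, ψ⟩, ⟨-φ, -ψ, -1⟩, ⟨-ψ, -1, φ⟩, ⟨⟨2, 4⟩, ⟨4, 6⟩, ⟨2, 2⟩⟩⟩),
    ((some .T₃, 0), ⟨⟨φ, ψ, -1⟩, ⟨ψ, 1, φ⟩, ⟨-1, φ, -ψ⟩, ⟨0, 0, 0⟩⟩),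
    ((some .T₃, 0), ⟨⟨-2, 0, 0⟩, ⟨0, 2, 0⟩, ⟨0, 0, -2⟩, ⟨⟨4, 8⟩, 0, 0⟩⟩),
    ((some .T₃, 0), ⟨⟨-1, φ, ψ⟩, ⟨-φ, -ψ, -1⟩, ⟨ψ, 1, -φ⟩, ⟨⟨2, 4⟩, ⟨4, 6⟩, ⟨-2, -2⟩⟩⟩),
    ((some .T₃, 0), ⟨⟨-φ, ψ, -1⟩, ⟨ψ, -1, -φ⟩, ⟨1, φ, -ψ⟩, ⟨⟨4, 6⟩, ⟨2, 2⟩, ⟨-2, -4⟩⟩⟩)]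

theorem dissectionCheck_T₄Two : dissectionCheck (some .T₄, 2) piecesT₄Two [
    ⟨⟨1, 0, -φ⟩, ⟨-4, -8⟩⟩, ⟨⟨0, φ, -1⟩, ⟨-4, -8⟩⟩, ⟨⟨φ, -1, 0⟩, ⟨-4, -8⟩⟩,
    ⟨⟨0, φ, 1⟩, ⟨-4, -8⟩⟩, ⟨⟨φ, 1, 0⟩, ⟨-4, -4⟩⟩] = true := by
  decide +kernel

def piecesT₁Two : List (Label × Motion) := [
    ((none, 0), ⟨⟨-2, 0, 0⟩, ⟨0, -2, 0⟩, ⟨0, 0, -2⟩, ⟨0, 0, ⟨0, -2⟩⟩⟩),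
    ((some .T₂, 1), ⟨⟨ψ, -1, φ⟩, ⟨-1, -φ, -ψ⟩, ⟨-φ, ψ, 1⟩, ⟨⟨-1, -1⟩, ⟨-1, -2⟩, -φ⟩⟩),
    ((some .T₂, 1), ⟨⟨0, -2, 0⟩, ⟨0, 0, -2⟩, ⟨-2, 0, 0⟩, ⟨0, ⟨2, 4⟩, 0⟩⟩),
    ((some .T₃, 1), ⟨⟨-1, φ, ψ⟩, ⟨-φ, -ψ, -1⟩, ⟨-ψ, -1, φ⟩, ⟨0, ⟨2, 4⟩, ⟨2, 4⟩⟩⟩),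
    ((some .T₄, 1), ⟨⟨1, φ, ψ⟩, ⟨-φ, ψ, 1⟩, ⟨ψ, -1, φ⟩, ⟨⟨-2, -2⟩, 0, ⟨2, 2⟩⟩⟩),
    ((some .T₂, 0), ⟨⟨-2, 0, 0⟩, ⟨0, -2, 0⟩, ⟨0, 0, -2⟩, ⟨0, 0, ⟨2, 2⟩⟩⟩),
    ((some .T₃, 0), ⟨⟨-1, φ, ψ⟩, ⟨φ, ψ, 1⟩, ⟨ψ, 1, -φ⟩, ⟨0, ⟨-2, -4⟩, ⟨-2, -4⟩⟩⟩),
    ((some .T₃, 0), ⟨⟨-1, φ, ψ⟩, ⟨-φ, -ψ, -1⟩, ⟨ψ, 1, -φ⟩, ⟨0, ⟨2, 4⟩, ⟨-2, -4⟩⟩⟩),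
    ((some .T₃, 0), ⟨⟨-φ, ψ, -1⟩, ⟨ψ, -1, -φ⟩, ⟨-1, -φ, ψ⟩, ⟨⟨2, 2⟩, 0, ⟨2, 2⟩⟩⟩),
    ((some .T₃, 0), ⟨⟨ψ, 1, -φ⟩, ⟨-1, φ, ψ⟩, ⟨-φ, -ψ, -1⟩, ⟨⟨-2, -2⟩, 0, ⟨2, 2⟩⟩⟩)]

theorem dissectionCheck_T₁Two : dissectionCheck (some .T₁, 2) piecesT₁Two [
    ⟨⟨0, φ, 1⟩, ⟨-2, -2⟩⟩, ⟨⟨1, 0, φ⟩, ⟨0, -2⟩⟩, ⟨⟨0, φ, -1⟩, ⟨2, 2⟩⟩, ⟨⟨1, 0, -φ⟩, ⟨0, 2⟩⟩,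
    ⟨⟨0, φ, 1⟩, ⟨2, 6⟩⟩, ⟨⟨0, φ, -1⟩, ⟨-2, -6⟩⟩, ⟨⟨0, φ, -1⟩, ⟨-2, -2⟩⟩] = true := by
  decide +kernel

/-! ### Substitution and dilation of dissections. -/

/-- Freedom in the index type allows pairs (piece, piece of that piece) when dissections are nested.
-/
theorem dissects_of_fintype {ι : Type*} [Fintype ι] {A : Set Space} {S : Multiset (Set Space)}
    (proto piece : ι → Set Space) (hS : ∑ k, {proto k} = S)
    (hp : ∀ k, ∃ e : Space ≃ᵢ Space, piece k = e '' proto k) (hA : A = ⋃ k, piece k)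
    (hd : Pairwise fun k l => Disjoint (interior (piece k)) (interior (piece l))) :
    Dissects A S := by
  let e : Fin (Fintype.card ι) ≃ ι := (Fintype.equivFin ι).symm
  refine ⟨Fintype.card ι, proto ∘ e, piece ∘ e, ?_, fun k => hp (e k), ?_, ?_⟩
  · rw [← hS, ← e.sum_comp, ← Fin.univ_val_map, Finset.sum, ← Multiset.sum_map_singleton
      (Finset.univ.val.map (proto ∘ e)), Multiset.map_map]
    rfl
  · rw [hA, ← e.surjective.iUnion_comp]
    rfl
  · exact fun k l hkl => hd (e.injective.ne hkl)

theorem dissects_iff_exists_fin {A : Set Space} {S : Multiset (Set Space)} :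
    Dissects A S ↔ ∃ (m : ℕ) (proto piece : Fin m → Set Space), ∑ k, {proto k} = S ∧
      (∀ k, ∃ e : Space ≃ᵢ Space, piece k = e '' proto k) ∧ A = (⋃ k, piece k) ∧
      Pairwise fun k l => Disjoint (interior (piece k)) (interior (piece l)) := by
  constructor
  · rintro ⟨m, proto, piece, hS, h⟩
    refine ⟨m, proto, piece, ?_, h⟩
    rw [← hS, ← Fin.univ_val_map, Finset.sum, ← Multiset.sum_map_singleton
      (Finset.univ.val.map proto), Multiset.map_map]
    rfl
  · rintro ⟨m, proto, piece, hS, hp, hA, hd⟩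
    exact dissects_of_fintype proto piece hS hp hA hd

theorem dissects_self (A : Set Space) : Dissects A {A} :=
  dissects_of_fintype (ι := Unit) (fun _ => A) (fun _ => A) (by simp)
    (fun _ => ⟨IsometryEquiv.refl _, (Set.image_id A).symm⟩) (Set.iUnion_const A).symm
    (fun _ _ h => absurd rfl h)

theorem interior_image_isometry (e : Space ≃ᵢ Space) (A : Set Space) :
    interior (e '' A) = e '' interior A :=
  (e.toHomeomorph.image_interior A).symm

/-- The pieces of a dissection can be dissected further. -/
theorem dissects_sum {m : ℕ} {A : Set Space} {proto piece : Fin m → Set Space}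
    (hp : ∀ k, ∃ e : Space ≃ᵢ Space, piece k = e '' proto k) (hA : A = ⋃ k, piece k)
    (hd : Pairwise fun k l => Disjoint (interior (piece k)) (interior (piece l)))
    {R : Fin m → Multiset (Set Space)} (hR : ∀ k, Dissects (proto k) (R k)) :
    Dissects A (∑ k, R k) := by
  simp only [dissects_iff_exists_fin] at hR
  choose n proto' piece' hS' hp' hA' hd' using hR
  choose e he using hp
  choose e' he' using hp'
  refine dissects_of_fintype (ι := Σ k, Fin (n k)) (fun i => proto' i.1 i.2)
    (fun i => e i.1 '' piece' i.1 i.2) ?_ (fun i => ⟨(e' i.1 i.2).trans (e i.1), ?_⟩) ?_ ?_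
  · rw [Fintype.sum_sigma]
    exact Finset.sum_congr rfl fun k _ => hS' k
  · rw [he' i.1 i.2, Set.image_image]
    rfl
  · rw [hA, Set.iUnion_sigma]
    refine Set.iUnion_congr fun k => ?_
    rw [he k, hA' k, Set.image_iUnion]
  -- Subpieces of one piece are disjoint because the isometry is injective, those of different
  -- pieces because their interiors lie in disjoint interiors.
  · rintro ⟨k, i⟩ ⟨l, j⟩ hne
    by_cases hkl : k = l
    · subst hkl
      have hij : i ≠ j := fun h => hne (by rw [h])
      simp only [interior_image_isometry]
      exact (Set.disjoint_image_iff (e k).injective).mpr (hd' k hij)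
    · have hsub : ∀ k i, interior (e k '' piece' k i) ⊆ interior (piece k) := fun k i => by
        refine interior_mono ?_
        rw [he k, hA' k]
        exact Set.image_mono (Set.subset_iUnion _ i)
      exact (hd hkl).mono (hsub k i) (hsub l j)

/-- One piece of a dissection can be replaced by a dissection of it. -/
theorem Dissects.replace {A B : Set Space} {R S : Multiset (Set Space)}
    (h : Dissects A ({B} + S)) (hB : Dissects B R) : Dissects A (R + S) := by
  obtain ⟨m, proto, piece, hS, hp, hA, hd⟩ := dissects_iff_exists_fin.mp h
  have hmem : B ∈ ∑ k, ({proto k} : Multiset (Set Space)) := by rw [hS]; simp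
  obtain ⟨k₀, -, hk₀⟩ := Multiset.mem_sum.mp hmem
  obtain rfl := Multiset.mem_singleton.mp hk₀
  -- Only the piece with index k₀, whose prototype is B, is dissected; every other piece is kept
  -- whole.
  have hs : ∀ T : Multiset (Set Space), ∑ k, (if k = k₀ then T else {proto k}) =
      T + ∑ k ∈ Finset.univ.erase k₀, {proto k} := fun T => by
    rw [← Finset.add_sum_erase _ _ (Finset.mem_univ k₀), if_pos rfl]
    congr 1
    exact Finset.sum_congr rfl fun k hk => if_neg (Finset.ne_of_mem_erase hk)
  have hS' : S = ∑ k ∈ Finset.univ.erase k₀, {proto k} := by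
    rw [← Finset.add_sum_erase _ _ (Finset.mem_univ k₀)] at hS
    exact (add_left_cancel hS).symm
  rw [hS', ← hs R]
  refine dissects_sum hp hA hd fun k => ?_
  split_ifs with hk
  · exact hk ▸ hB
  · exact dissects_self _

/-- All pieces of a dissection can be replaced by dissections of them. -/
theorem DissectsInto.sum_map {l : Label} {m : Multiset Label} (h : DissectsInto l m)
    {R : Label → Multiset (Set Space)} (hR : ∀ l' ∈ m, Dissects l'.solid (R l')) :
    Dissects l.solid (m.map R).sum := by
  -- The summand S collects the parts already substituted while the induction runs through m.
  have key : ∀ (m : Multiset Label) (S : Multiset (Set Space)),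
      (∀ l' ∈ m, Dissects l'.solid (R l')) → Dissects l.solid (m.map Label.solid + S) →
      Dissects l.solid ((m.map R).sum + S) := by
    intro m
    induction m using Multiset.induction with
    | empty => exact fun S _ h => by simpa using h
    | cons a m ih =>
      intro S hm h
      rw [Multiset.map_cons, Multiset.sum_cons, add_assoc]
      rw [Multiset.map_cons, ← Multiset.singleton_add, add_assoc] at h
      have h1 := h.replace (hm a (Multiset.mem_cons_self a m))
      rw [add_left_comm] at h1 ⊢
      exact ih _ (fun l' hl' => hm l' (Multiset.mem_cons_of_mem hl')) h1
  simpa using key m 0 hR (by rwa [add_zero])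

/-- An isometry of space, conjugated by a dilation. -/
noncomputable def conjDilation (c : ℝ) (hc : c ≠ 0) (e : Space ≃ᵢ Space) : Space ≃ᵢ Space :=
  IsometryEquiv.mk' (fun x => c • e (c⁻¹ • x)) (fun x => c • e.symm (c⁻¹ • x))
    (fun x => by simp [smul_smul, hc])
    (Isometry.of_dist_eq fun x y => by
      rw [dist_smul₀, e.dist_eq, dist_smul₀, ← mul_assoc, norm_inv,
        mul_inv_cancel₀ (norm_ne_zero_iff.mpr hc), one_mul])

theorem conjDilation_image (c : ℝ) (hc : c ≠ 0) (e : Space ≃ᵢ Space) (A : Set Space) :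
    conjDilation c hc e '' (c • A) = c • (e '' A) := by
  ext x
  simp only [Set.mem_image, Set.mem_smul_set, exists_exists_and_eq_and]
  refine exists_congr fun a => and_congr_right fun _ => ?_
  change c • e (c⁻¹ • c • a) = x ↔ _
  rw [inv_smul_smul₀ hc]

/-- An isometry conjugated by the dilation is again an isometry and matches the dilated prototype
with the dilated piece. -/
theorem Dissects.smul {A : Set Space} {S : Multiset (Set Space)} (h : Dissects A S) {c : ℝ}
    (hc : c ≠ 0) : Dissects (c • A) (S.map (c • ·)) := by
  obtain ⟨m, proto, piece, hS, hp, hA, hd⟩ := h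
  refine ⟨m, fun k => c • proto k, fun k => c • piece k, ?_, fun k => ?_, ?_, fun k l hkl => ?_⟩
  · rw [← hS, Multiset.map_coe, List.map_ofFn]
    rfl
  · obtain ⟨e, he⟩ := hp k
    exact ⟨conjDilation c hc e, by simp only [conjDilation_image, he]⟩
  · rw [hA, Set.smul_set_iUnion]
  · simp only [interior_smul₀ hc]
    exact (Set.disjoint_image_iff (smul_right_injective Space hc)).mpr (hd hkl)

/-- Dissections can be inflated. -/
theorem DissectsInto.infl {s : Option Tile} {n : ℕ} {m : Multiset Label}
    (h : DissectsInto (s, n) m) (k : ℕ) :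
    DissectsInto (s, n + k) (m.map fun l => (l.1, l.2 + k)) := by
  have hs : ∀ (s : Option Tile) (n : ℕ), Label.solid (s, n + k) = τ ^ k • Label.solid (s, n) :=
    fun s n => by
      rw [Label.solid_eq_smul, Label.solid_eq_smul, smul_smul, pow_add, mul_comm]
  have h1 := Dissects.smul h (Label.pow_pos k).ne'
  rw [DissectsInto, hs]
  convert h1 using 1
  rw [Multiset.map_map, Multiset.map_map]
  exact Multiset.map_congr rfl fun l _ => hs l.1 l.2

/-- The multiset sum unfolds to the list of labels in the certificate, whose pieces are ordered to
match. -/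
theorem dissectsInto_T₁_one : DissectsInto (some .T₁, 1)
    ({(some .T₁, 0)} + 2 • {(some .T₂, 0)} + 2 • {(some .T₃, 0)} + 2 • {(some .T₄, 0)}) :=
  dissectsInto_of_check dissectionCheck_T₁One

theorem dissectsInto_T₂_one : DissectsInto (some .T₂, 1)
    (2 • {(some .T₂, 0)} + {(some .T₃, 0)}) :=
  dissectsInto_of_check dissectionCheck_T₂One

theorem dissectsInto_T₃_one : DissectsInto (some .T₃, 1)
    ({(some .T₁, 0)} + 2 • {(some .T₂, 0)} + {(some .T₃, 0)} + {(some .T₄, 0)}) :=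
  dissectsInto_of_check dissectionCheck_T₃One

theorem dissectsInto_T₄_one : DissectsInto (some .T₄, 1)
    ({(some .T₁, 0)} + {(some .T₂, 0)} + {(some .T₃, 0)} + {(some .T₄, 0)}) :=
  dissectsInto_of_check dissectionCheck_T₄One

theorem dissectsInto_dod : DissectsInto (none, 0)
    (3 • {(some .T₁, 0)} + 4 • {(some .T₂, 0)} + 4 • {(some .T₄, 0)}) :=
  dissectsInto_of_check dissectionCheck_Dod

theorem dissectsInto_T₁_two : DissectsInto (some .T₁, 2)
    ({(none, 0)} + 2 • {(some .T₂, 1)} + {(some .T₃, 1)} + {(some .T₄, 1)} + {(some .T₂, 0)} +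
      4 • {(some .T₃, 0)}) :=
  dissectsInto_of_check dissectionCheck_T₁Two

theorem dissectsInto_T₃_two : DissectsInto (some .T₃, 2)
    ({(none, 0)} + 5 • {(some .T₂, 0)} + 6 • {(some .T₃, 0)}) :=
  dissectsInto_of_check dissectionCheck_T₃Two

theorem dissectsInto_T₄_two : DissectsInto (some .T₄, 2)
    ({(none, 0)} + 3 • {(some .T₂, 0)} + 5 • {(some .T₃, 0)}) :=
  dissectsInto_of_check dissectionCheck_T₄Two

/-! ### Counting pieces by recursion. -/

/-- Numbers of the dodecahedra `d(1)` and `d(τ)` and of the four composite tiles. -/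
abbrev Content : Type := ℕ × ℕ × ℕ × ℕ × ℕ × ℕ

namespace Content

/-- The number of composite tiles of each type. -/
def tileCount (v : Content) : Tile → ℕ
  | .T₁ => v.2.2.1
  | .T₂ => v.2.2.2.1
  | .T₃ => v.2.2.2.2.1
  | .T₄ => v.2.2.2.2.2

/-- The multiset of solids with the given numbers. -/
noncomputable def toMultiset (v : Content) : Multiset (Set Space) :=
  dodContent v.1 v.2.1 v.tileCount

theorem toMultiset_add (v w : Content) : (v + w).toMultiset = v.toMultiset + w.toMultiset := by
  simp only [toMultiset, dodContent, tileCount, Prod.fst_add, Prod.snd_add, add_smul]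
  abel

theorem toMultiset_sum_map (m : Multiset Label) (f : Label → Content) :
    (m.map f).sum.toMultiset = (m.map fun l => (f l).toMultiset).sum := by
  induction m using Multiset.induction with
  | empty => simp [toMultiset, dodContent, tileCount]
  | cons a m ih => simp only [Multiset.map_cons, Multiset.sum_cons, toMultiset_add, ih]

end Content

/-- The solid with label `l` can be dissected into dodecahedra and tiles in the given numbers. -/
def HasContent (l : Label) (v : Content) : Prop := Dissects l.solid v.toMultiset

theorem DissectsInto.hasContent {l : Label} {m : Multiset Label} (h : DissectsInto l m)
    {f : Label → Content} (hf : ∀ l' ∈ m, HasContent l' (f l')) :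
    HasContent l (m.map f).sum := by
  rw [HasContent, Content.toMultiset_sum_map]
  exact h.sum_map hf

/-- Contents of the inflated solids. -/
def contents : ℕ → Option Tile → Content
  | 0, none => (1, 0, 0, 0, 0, 0)
  | 0, some .T₁ => (0, 0, 1, 0, 0, 0)
  | 0, some .T₂ => (0, 0, 0, 1, 0, 0)
  | 0, some .T₃ => (0, 0, 0, 0, 1, 0)
  | 0, some .T₄ => (0, 0, 0, 0, 0, 1)
  | 1, none => (0, 1, 0, 0, 0, 0)
  | 1, some .T₁ => (0, 0, 1, 2, 2, 2)
  | 1, some .T₂ => (0, 0, 0, 2, 1, 0)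
  | 1, some .T₃ => (0, 0, 1, 2, 1, 1)
  | 1, some .T₄ => (0, 0, 1, 1, 1, 1)
  | n + 2, some .T₁ => contents n none + 2 • contents (n + 1) (some .T₂) +
      contents (n + 1) (some .T₃) + contents (n + 1) (some .T₄) + contents n (some .T₂) +
      4 • contents n (some .T₃)
  | n + 2, some .T₂ => 2 • contents (n + 1) (some .T₂) + contents (n + 1) (some .T₃)
  | n + 2, some .T₃ => contents n none + 5 • contents n (some .T₂) + 6 • contents n (some .T₃)
  | n + 2, some .T₄ => contents n none + 3 • contents n (some .T₂) + 5 • contents n (some .T₃)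
  -- This is 3T₁ + 4T₂ + 4T₄ at order n + 2 with the tile contents written out, so that the
  -- recursion only calls n and n + 1.
  | n + 2, none => 3 • (contents n none + 2 • contents (n + 1) (some .T₂) +
      contents (n + 1) (some .T₃) + contents (n + 1) (some .T₄) + contents n (some .T₂) +
      4 • contents n (some .T₃)) +
      4 • (2 • contents (n + 1) (some .T₂) + contents (n + 1) (some .T₃)) +
      4 • (contents n none + 3 • contents n (some .T₂) + 5 • contents n (some .T₃))

theorem DissectsInto.hasContent_contents {s : Option Tile} {k : ℕ} {m : Multiset Label}
    (h : DissectsInto (s, k) m) (j : ℕ)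
    (hm : ∀ l ∈ m, HasContent (l.1, l.2 + j) (contents (l.2 + j) l.1)) :
    HasContent (s, k + j) (m.map fun l => contents (l.2 + j) l.1).sum := by
  have := (h.infl j).hasContent (f := fun l => contents l.2 l.1) (by
    intro l hl
    obtain ⟨l', hl', rfl⟩ := Multiset.mem_map.mp hl
    exact hm l' hl')
  rwa [Multiset.map_map] at this

theorem hasContent_zero (s : Option Tile) : HasContent (s, 0) (contents 0 s) := by
  rcases s with (_ | _ | _ | _ | _) <;>
    simpa [HasContent, Content.toMultiset, Content.tileCount, dodContent, contents, Label.solid]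
      using dissects_self _

theorem hasContent_one (s : Option Tile) : HasContent (s, 1) (contents 1 s) := by
  have h : ∀ (s : Option Tile) (m : Multiset Label), DissectsInto (s, 1) m →
      (∀ l ∈ m, l.2 = 0) → (m.map fun l => contents (l.2 + 0) l.1).sum = contents 1 s →
      HasContent (s, 1) (contents 1 s) := by
    intro s m h1 h2 h3
    rw [← h3]
    refine h1.hasContent_contents 0 ?_
    rintro ⟨t, n⟩ hl
    obtain rfl := h2 _ hl
    exact hasContent_zero t
  rcases s with (_ | _ | _ | _ | _)
  · simpa [HasContent, Content.toMultiset, Content.tileCount, dodContent, contents, Label.solid]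
      using dissects_self _
  · exact h _ _ dissectsInto_T₁_one (by decide) (by decide)
  · exact h _ _ dissectsInto_T₂_one (by decide) (by decide)
  · exact h _ _ dissectsInto_T₃_one (by decide) (by decide)
  · exact h _ _ dissectsInto_T₄_one (by decide) (by decide)

/-- The rules lower the order by at most two, whence the two-step induction. The dodecahedron comes
after the tiles, as it is split into tiles of the same order. -/
theorem hasContent_contents (n : ℕ) : ∀ s, HasContent (s, n) (contents n s) := by
  induction n using Nat.twoStepInduction with
  | zero => exact hasContent_zero
  | one => exact hasContent_one
  | more n h0 h1 =>
    have key : ∀ (s : Option Tile) (m : Multiset Label), DissectsInto (s, 2) m →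
        (∀ l ∈ m, l.2 = 0 ∨ l.2 = 1) →
        (m.map fun l => contents (l.2 + n) l.1).sum = contents (n + 2) s →
        HasContent (s, n + 2) (contents (n + 2) s) := by
      intro s m h h2 h3
      rw [← h3, add_comm n 2]
      refine h.hasContent_contents n ?_
      rintro ⟨t, k⟩ hl
      obtain rfl | rfl := h2 _ hl
      · simpa using h0 t
      · simpa [add_comm 1 n] using h1 t
    have hT₁ := key _ _ dissectsInto_T₁_two (by decide) (by
      simp only [contents, Multiset.map_add, Multiset.map_nsmul, Multiset.map_singleton,
        Multiset.sum_add, Multiset.sum_nsmul, Multiset.sum_singleton, zero_add, add_comm 1 n])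
    have hT₃ := key _ _ dissectsInto_T₃_two (by decide) (by
      simp only [contents, Multiset.map_add, Multiset.map_nsmul, Multiset.map_singleton,
        Multiset.sum_add, Multiset.sum_nsmul, Multiset.sum_singleton, zero_add])
    have hT₄ := key _ _ dissectsInto_T₄_two (by decide) (by
      simp only [contents, Multiset.map_add, Multiset.map_nsmul, Multiset.map_singleton,
        Multiset.sum_add, Multiset.sum_nsmul, Multiset.sum_singleton, zero_add])
    -- T₂ has no certificate at order two; its order-one rule is inflated once.
    have hT₂ := key _ _ (dissectsInto_T₂_one.infl 1) (by decide) (by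
      simp only [contents, Multiset.map_add, Multiset.map_nsmul, Multiset.map_singleton,
        Multiset.sum_add, Multiset.sum_nsmul, Multiset.sum_singleton, zero_add, add_comm 1 n])
    rintro (_ | _ | _ | _ | _)
    · have h := dissectsInto_dod.hasContent_contents (n + 2) (by
        rintro ⟨t, k⟩ hl
        simp only [Multiset.mem_add, Multiset.mem_nsmul, Multiset.mem_singleton,
          Prod.mk.injEq] at hl
        rcases hl with (⟨-, rfl, rfl⟩ | ⟨-, rfl, rfl⟩) | ⟨-, rfl, rfl⟩ <;> rw [zero_add]
        exacts [hT₁, hT₂, hT₄])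
      rw [zero_add] at h
      convert h using 1
      simp only [Multiset.map_add, Multiset.map_nsmul, Multiset.map_singleton,
        Multiset.sum_add, Multiset.sum_nsmul, Multiset.sum_singleton, zero_add]
      simp only [contents]
    exacts [hT₁, hT₂, hT₃, hT₄]

/-! ### Both dodecahedra at all large orders. -/

/-- Dissections whose parts contain at least the solids in `u` contain at least these solids. -/
theorem DissectsInto.exists_le {s : Option Tile} {k j : ℕ} {m : Multiset Label} {u : Content}
    (h : DissectsInto (s, k) m) (hm : m ≠ 0)
    (hu : ∀ l ∈ m, ∃ v, u ≤ v ∧ HasContent (l.1, l.2 + j) v) :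
    ∃ v, u ≤ v ∧ HasContent (s, k + j) v := by
  have hex : ∀ l : Label, ∃ v, l ∈ m.map (fun l => (l.1, l.2 + j)) → u ≤ v ∧ HasContent l v := by
    intro l
    by_cases hl : l ∈ m.map (fun l => (l.1, l.2 + j))
    · obtain ⟨l', hl', rfl⟩ := Multiset.mem_map.mp hl
      obtain ⟨v, hv⟩ := hu l' hl'
      exact ⟨v, fun _ => hv⟩
    · exact ⟨0, fun h => absurd h hl⟩
  choose f hf using hex
  refine ⟨_, ?_, (h.infl j).hasContent fun l hl => (hf l hl).2⟩
  -- A single part already contributes u, and the other parts can only add to it.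
  obtain ⟨l, hl⟩ := Multiset.exists_mem_of_ne_zero hm
  have hl' := Multiset.mem_map_of_mem (fun l : Label => (l.1, l.2 + j)) hl
  obtain ⟨m', hm'⟩ := Multiset.exists_cons_of_mem hl'
  rw [hm', Multiset.map_cons, Multiset.sum_cons]
  exact (hf _ hl').1.trans le_self_add

/-- The base case at order four goes through the order-one rule and the contents at order three:
`contents 4` contains no d(τ) for T₃ and T₄, whose order-two rules lead only to solids of order two.
The third 1 in the bound provides a composite tile. -/
theorem dissectsInto_tile_one (i : Tile) : ∃ m, DissectsInto (some i, 1) m ∧ m ≠ 0 ∧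
    (∀ l ∈ m, l.1.isSome = true ∧ l.2 = 0) ∧
    ((1, 1, 1, 0, 0, 0) : Content) ≤ (m.map fun l => contents (l.2 + 3) l.1).sum := by
  cases i
  exacts [⟨_, dissectsInto_T₁_one, by simp, by decide, by decide +kernel⟩,
    ⟨_, dissectsInto_T₂_one, by simp, by decide, by decide +kernel⟩,
    ⟨_, dissectsInto_T₃_one, by simp, by decide, by decide +kernel⟩,
    ⟨_, dissectsInto_T₄_one, by simp, by decide, by decide +kernel⟩]

theorem exists_hasContent_tile (n : ℕ) :
    ∀ i, ∃ v, ((1, 1, 1, 0, 0, 0) : Content) ≤ v ∧ HasContent (some i, n + 4) v := by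
  induction n with
  | zero =>
    intro i
    obtain ⟨m, hm, -, -, hv⟩ := dissectsInto_tile_one i
    exact ⟨_, hv, hm.hasContent_contents 3 fun l _ => hasContent_contents (l.2 + 3) l.1⟩
  | succ n ih =>
    intro i
    obtain ⟨m, hm, h0, hl, -⟩ := dissectsInto_tile_one i
    rw [show n + 1 + 4 = 1 + (n + 4) by omega]
    refine hm.exists_le h0 fun l hlm => ?_
    obtain ⟨t, k⟩ := l
    obtain ⟨ht, rfl⟩ := hl _ hlm
    obtain ⟨t, rfl⟩ := Option.isSome_iff_exists.mp ht
    rw [zero_add]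
    exact ih t

/-- At order three the recursion gives the bound directly; from order four on, the dodecahedron is
split into tiles of the same order, to which the bound for tiles applies. -/
theorem exists_hasContent_dod (n : ℕ) :
    ∃ v, ((1, 1, 1, 0, 0, 0) : Content) ≤ v ∧ HasContent (none, n + 3) v := by
  cases n with
  | zero => exact ⟨_, by decide +kernel, hasContent_contents 3 none⟩
  | succ n =>
    rw [show n + 1 + 3 = 0 + (n + 4) by omega]
    refine dissectsInto_dod.exists_le (by simp) fun l hl => ?_
    obtain ⟨t, k⟩ := l
    have h : ∀ l ∈ (3 • {(some .T₁, 0)} + 4 • {(some .T₂, 0)} + 4 • {(some .T₄, 0)} :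
        Multiset Label), l.1.isSome = true ∧ l.2 = 0 := by decide
    obtain ⟨ht, rfl⟩ := h _ hl
    obtain ⟨t, rfl⟩ := Option.isSome_iff_exists.mp ht
    rw [zero_add]
    exact exists_hasContent_tile n t

theorem contents_two_none : contents 2 none = (7, 0, 10, 60, 56, 10) := by decide +kernel

theorem contents_ten_none : contents 10 none =
    (432139, 92850, 1064050, 6341550, 4720730, 1064050) := by decide +kernel

/-! ### Dissections into solids of several orders. -/

theorem DissectsInto.bind {l : Label} {m : Multiset Label} (h : DissectsInto l m)
    {F : Label → Multiset Label} (hF : ∀ l' ∈ m, DissectsInto l' (F l')) :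
    DissectsInto l (m.bind F) := by
  rw [DissectsInto, Multiset.map_bind, Multiset.bind]
  exact h.sum_map hF

/-- Dissections of some inflated solids that bring out dodecahedra. -/
def dodecahedralRule : Label → Multiset Label
  | (none, 2) => 3 • ({(none, 0)} + 2 • {(some .T₂, 1)} + {(some .T₃, 1)} + {(some .T₄, 1)} +
      {(some .T₂, 0)} + 4 • {(some .T₃, 0)}) + 4 • {(some .T₂, 2)} +
      4 • ({(none, 0)} + 3 • {(some .T₂, 0)} + 5 • {(some .T₃, 0)})
  | (some .T₁, 2) => {(none, 0)} + 2 • {(some .T₂, 1)} + {(some .T₃, 1)} + {(some .T₄, 1)} +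
      {(some .T₂, 0)} + 4 • {(some .T₃, 0)}
  | (some .T₂, 3) => {(none, 0)} + 2 • {(some .T₂, 2)} + 5 • {(some .T₂, 0)} +
      6 • {(some .T₃, 0)}
  | (some .T₃, 2) => {(none, 0)} + 5 • {(some .T₂, 0)} + 6 • {(some .T₃, 0)}
  | (some .T₃, 3) => {(none, 1)} + 5 • {(some .T₂, 1)} + 6 • {(some .T₃, 1)}
  | (some .T₄, 2) => {(none, 0)} + 3 • {(some .T₂, 0)} + 5 • {(some .T₃, 0)}
  | (some .T₄, 3) => {(none, 1)} + 3 • {(some .T₂, 1)} + 5 • {(some .T₃, 1)}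
  | l => {l}

instance : DecidableEq Tile := fun a b => by
  cases a <;> cases b <;> first | exact isTrue rfl | exact isFalse (by simp)

theorem dissectsInto_self (l : Label) : DissectsInto l {l} := dissects_self _

theorem DissectsInto.of_eq {l : Label} {m m' : Multiset Label} (h : DissectsInto l m)
    (hm : m = m') : DissectsInto l m' := hm ▸ h

/-- Dissections of the composite tiles of order two bring out dodecahedra. -/
def orderTwoRule : Label → Multiset Label
  | (some .T₁, 2) => dodecahedralRule (some .T₁, 2)
  | (some .T₃, 2) => dodecahedralRule (some .T₃, 2)
  | (some .T₄, 2) => dodecahedralRule (some .T₄, 2)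
  | l => {l}

theorem dissectsInto_orderTwoRule (l : Label) : DissectsInto l (orderTwoRule l) := by
  unfold orderTwoRule
  split
  exacts [dissectsInto_T₁_two, dissectsInto_T₃_two, dissectsInto_T₄_two, dissectsInto_self _]

theorem dissectsInto_dodecahedralRule (l : Label) : DissectsInto l (dodecahedralRule l) := by
  unfold dodecahedralRule
  split
  -- Of the tiles of order two in d(τ²), only T₁ and T₄ are split further; T₂ stays whole.
  · exact ((dissectsInto_dod.infl 2).bind fun l _ => dissectsInto_orderTwoRule l).of_eq
      (by decide +kernel)
  · exact dissectsInto_T₁_two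
  · exact ((dissectsInto_T₂_one.infl 2).bind fun l _ => dissectsInto_orderTwoRule l).of_eq
      (by decide +kernel)
  · exact dissectsInto_T₃_two
  · exact (dissectsInto_T₃_two.infl 1).of_eq (by decide +kernel)
  · exact dissectsInto_T₄_two
  · exact (dissectsInto_T₄_two.infl 1).of_eq (by decide +kernel)
  · exact dissectsInto_self _

theorem dissectsInto_T₂_three : DissectsInto (some .T₂, 3)
    ({(none, 0)} + 2 • {(some .T₂, 2)} + 5 • {(some .T₂, 0)} + 6 • {(some .T₃, 0)}) :=
  dissectsInto_dodecahedralRule (some .T₂, 3)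

theorem dissectsInto_T₂_four : DissectsInto (some .T₂, 4)
    (2 • {(none, 0)} + {(none, 1)} + 4 • {(some .T₂, 2)} + 5 • {(some .T₂, 1)} +
      6 • {(some .T₃, 1)} + 10 • {(some .T₂, 0)} + 12 • {(some .T₃, 0)}) :=
  ((dissectsInto_T₂_three.infl 1).bind fun l _ => dissectsInto_dodecahedralRule l).of_eq
    (by decide +kernel)

/-- The inflated rule produces a d(τ²), which must be split as well. The 13 small dodecahedra are 7
from it, 2 from two T₂ of order three and 4 from four T₃ of order two. -/
theorem dissectsInto_T₁_four : DissectsInto (some .T₁, 4)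
    (13 • {(none, 0)} + 2 • {(none, 1)} + 9 • {(some .T₂, 2)} + 14 • {(some .T₂, 1)} +
      14 • {(some .T₃, 1)} + 3 • {(some .T₄, 1)} + 45 • {(some .T₂, 0)} +
      68 • {(some .T₃, 0)}) :=
  ((dissectsInto_T₁_two.infl 2).bind fun l _ => dissectsInto_dodecahedralRule l).of_eq
    (by decide +kernel)

/-! ### The theorem. -/

theorem mainTheorem5 :
    -- dodecahedra in the inflated tiles of order two and three
    Dissects (infl T₁ 2)
      ({dod 0} + 2 • {infl T₂ 1} + {infl T₃ 1} + {infl T₄ 1} + {infl T₂ 0} + 4 • {infl T₃ 0}) ∧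
    Dissects (infl T₂ 3) ({dod 0} + 2 • {infl T₂ 2} + 5 • {infl T₂ 0} + 6 • {infl T₃ 0}) ∧
    Dissects (infl T₃ 2) ({dod 0} + 5 • {infl T₂ 0} + 6 • {infl T₃ 0}) ∧
    Dissects (infl T₄ 2) ({dod 0} + 3 • {infl T₂ 0} + 5 • {infl T₃ 0}) ∧
    -- both kinds of dodecahedra in inflated tiles of order four
    Dissects (infl T₂ 4)
      (2 • {dod 0} + {dod 1} + 4 • {infl T₂ 2} + 5 • {infl T₂ 1} + 6 • {infl T₃ 1} +
        10 • {infl T₂ 0} + 12 • {infl T₃ 0}) ∧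
    Dissects (infl T₁ 4)
      (13 • {dod 0} + 2 • {dod 1} + 9 • {infl T₂ 2} + 14 • {infl T₂ 1} + 14 • {infl T₃ 1} +
        3 • {infl T₄ 1} + 45 • {infl T₂ 0} + 68 • {infl T₃ 0}) ∧
    -- all higher inflations of all composite tiles contain both kinds of dodecahedra
    (∀ (i : Tile) (n : ℕ), 4 ≤ n → ∃ (a b : ℕ) (c : Tile → ℕ), 0 < a ∧ 0 < b ∧
      (∃ j, 0 < c j) ∧ Dissects (infl i n) (dodContent a b c)) ∧
    -- every inflated dodecahedron of order at least two
    (∀ n : ℕ, 2 ≤ n → ∃ (a b : ℕ) (c : Tile → ℕ), 0 < a ∧ (3 ≤ n → 0 < b) ∧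
      (n = 2 → a = 7 ∧ b = 0) ∧ (∃ j, 0 < c j) ∧ Dissects (dod n) (dodContent a b c)) ∧
    -- the dodecahedron of edge length `τ ^ 10`
    Dissects (dod 10)
      (432139 • {dod 0} + 92850 • {dod 1} + 1064050 • {infl T₁ 0} + 6341550 • {infl T₂ 0} +
        4720730 • {infl T₃ 0} + 1064050 • {infl T₄ 0}) := by
  have ex : ∀ {l : Label} {m : Multiset Label} {S : Multiset (Set Space)}, DissectsInto l m →
      m.map Label.solid = S → Dissects l.solid S := fun h hS => hS ▸ h
  refine ⟨ex dissectsInto_T₁_two ?_, ex dissectsInto_T₂_three ?_, ex dissectsInto_T₃_two ?_,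
    ex dissectsInto_T₄_two ?_, ex dissectsInto_T₂_four ?_, ex dissectsInto_T₁_four ?_,
    fun i n hn => ?_, fun n hn => ?_, ?_⟩
  any_goals simp only [Multiset.map_add, Multiset.map_nsmul, Multiset.map_singleton, Label.solid]
  · obtain ⟨k, rfl⟩ := Nat.exists_eq_add_of_le' hn
    obtain ⟨v, ⟨ha, hb, hc, -⟩, h⟩ := exists_hasContent_tile k i
    -- The first three entries of the bound (1, 1, 1, 0, 0, 0) give d(1), d(τ) and a copy of T₁.
    exact ⟨v.1, v.2.1, Content.tileCount v, ha, hb, ⟨.T₁, hc⟩, h⟩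
  · obtain rfl | hn := hn.eq_or_lt
    · exact ⟨7, 0, Content.tileCount (contents 2 none), by norm_num, by norm_num,
        fun _ => ⟨rfl, rfl⟩, ⟨.T₁, by decide +kernel⟩, by
          have h := hasContent_contents 2 none
          rw [contents_two_none] at h ⊢
          exact h⟩
    · obtain ⟨k, rfl⟩ := Nat.exists_eq_add_of_le' hn
      obtain ⟨v, ⟨ha, hb, hc, -⟩, h⟩ := exists_hasContent_dod k
      exact ⟨v.1, v.2.1, Content.tileCount v, ha, fun _ => hb, by omega, ⟨.T₁, hc⟩, h⟩
  · have h := hasContent_contents 10 none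
    rw [contents_ten_none] at h
    exact h
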